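/- Let $0<q<1$, and write $(x;q)_n=\prod_{k=0}^{n-1}(1-xq^k)$ for $n\ge 0$, $(x;q)_\infty=\prod_{k=0}^{\infty}(1-xq^k)$, and $(x_1,\dots,x_m;q)_n=(x_1;q)_n\cdots(x_m;q)_n$ for $0\le n\le\infty$. Put $$h(x;a|q)=\prod_{k=0}^\infty(1-2q^kax+q^{2k}a^2),\qquad h(x;a_1,\dots,a_m|q)=\prod_{j=1}^m h(x;a_j|q),$$ so that $h(\cos\theta;a|q)=(ae^{i\theta},ae^{-i\theta};q)_\infty$, and $${}_4\phi_3\left({a_1,a_2,a_3,a_4\atop b_1,b_2,b_3};q,x\right)=\sum_{n=0}^\infty\frac{(a_1,a_2,a_3,a_4;q)_n\,x^n}{(q,b_1,b_2,b_3;q)_n}.$$ Let $a,b,c,d,r,s,t,h,z,\beta,\delta$ be complex numbers with $\max\{|a|,|b|,|c|,|d|,|r|,|s|,|t|,|h|,|z|\}<1$, and let $\alpha=a^2bcdr/q$. Then $$\int_0^\pi\frac{h(\cos2\theta;1|q)}{h(\cos\theta;a,b,c,d,r|q)}\;{}_4\phi_3\left({ae^{i\theta},ae^{-i\theta},\beta,\delta\atop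 s,t,h};q,bcdrz\right)d\theta$$ $$=\frac{2\pi\,(abcd,abcr,abdr,acdr;q)_\infty}{(q,ab,ac,ad,ar,bc,bd,br,cd,cr,dr,q\alpha;q)_\infty}\sum_{n=0}^\infty\frac{(1-\alpha q^{2n})(\alpha,ab,ac,ad,ar;q)_n}{(1-\alpha)(q,abcd,abcr,abdr,acdr;q)_n}(-bcdr)^n q^{n(n-1)/2}\;{}_4\phi_3\left({q^{-n},\alpha q^n,\beta,\delta\atop s,t,h};q,qz\right),$$ where the ${}_4\phi_3$ under the integral converges absolutely for every real $\theta$, the integrand is integrable on $[0,\pi]$, and the series over $n$ converges absolutely. If $\alpha=1$, the factor $(1-\alpha q^{2n})(\alpha;q)_n/(1-\alpha)$ is understood as its limit as $\alpha\to1$, which is $1$ for $n=0$ and $(1-q^{2n})(q;q)_{n-1}$ for $n\ge1$. The same holds when $|z|=1$ (the other parameters being as before), provided that the series over $n$ on the right-hand side converges absolutely. -/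

import Mathlib

open MeasureTheory

noncomputable section

namespace QBeta

/-- The finite `q`-shifted factorial `(a; q)_n = ∏_{k=0}^{n-1} (1 - a q^k)`. -/
def qFac (q a : ℂ) (n : ℕ) : ℂ := ∏ k ∈ Finset.range n, (1 - a * q ^ k)

/-- The infinite `q`-shifted factorial `(a; q)_∞ = ∏_{k=0}^∞ (1 - a q^k)`; the product is
unconditionally convergent for `‖q‖ < 1`, see `multipliable_qFacInf`. -/
def qFacInf (q a : ℂ) : ℂ := ∏' k : ℕ, (1 - a * q ^ k)

/-- The multiple `q`-shifted factorial `(a₁, …, aₘ; q)_n`. -/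
def qFacs (q : ℂ) (as : List ℂ) (n : ℕ) : ℂ := (as.map fun a => qFac q a n).prod

/-- The multiple `q`-shifted factorial `(a₁, …, aₘ; q)_∞`. -/
def qFacsInf (q : ℂ) (as : List ℂ) : ℂ := (as.map fun a => qFacInf q a).prod

/-- The `n`-th term `(a₁, …, a_{r+1}; q)_n z^n / (q, b₁, …, b_r; q)_n` of a basic hypergeometric
series with upper parameters `as` and lower parameters `bs`. -/
def phiTerm (q : ℂ) (as bs : List ℂ) (z : ℂ) (n : ℕ) : ℂ :=
  qFacs q as n * z ^ n / qFacs q (q :: bs) n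

/-- The basic hypergeometric series `_{r+1}φ_r(a₁, …, a_{r+1}; b₁, …, b_r; q, z)`, to be used with
`as.length = bs.length + 1`. -/
def phi (q : ℂ) (as bs : List ℂ) (z : ℂ) : ℂ := ∑' n : ℕ, phiTerm q as bs z n

/-- `h(x; a | q) = ∏_{k=0}^∞ (1 - 2 q^k a x + q^{2k} a²)`. For `x = cos θ` this equals
`(a e^{iθ}, a e^{-iθ}; q)_∞`, see `hFun_cos`. -/
def hFun (q : ℂ) (x : ℝ) (a : ℂ) : ℂ :=
  ∏' k : ℕ, (1 - 2 * q ^ k * a * (x : ℂ) + q ^ (2 * k) * a ^ 2)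

/-- `h(x; a₁, …, aₘ | q) = h(x; a₁ | q) ⋯ h(x; aₘ | q)`. -/
def hFuns (q : ℂ) (x : ℝ) (as : List ℂ) : ℂ := (as.map fun a => hFun q x a).prod

/-- The very-well-poised factor `(1 - α q^{2n}) (α; q)_n / (1 - α)`. At `α = 1`, where this
expression is `0 / 0`, it stands for its limit as `α → 1`; see `vwpFactor_eq` for a formula that
covers both cases. -/
def vwpFactor (q α : ℂ) (n : ℕ) : ℂ :=
  if α = 1 then (if n = 0 then 1 else (1 - q ^ (2 * n)) * qFac q q (n - 1))
  else (1 - α * q ^ (2 * n)) * qFac q α n / (1 - α)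

theorem multipliable_qFacInf {q : ℂ} (hq : ‖q‖ < 1) (a : ℂ) :
    Multipliable fun k : ℕ => 1 - a * q ^ k := by
  have h : Summable fun k : ℕ => ‖-(a * q ^ k)‖ := by
    simp only [norm_neg, norm_mul, norm_pow]
    exact (summable_geometric_of_lt_one (norm_nonneg q) hq).mul_left _
  simpa [sub_eq_add_neg] using multipliable_one_add_of_summable h

theorem hFun_cos {q : ℂ} (hq : ‖q‖ < 1) (a : ℂ) (θ : ℝ) :
    hFun q (Real.cos θ) a =
      qFacsInf q [a * Complex.exp (θ * Complex.I), a * Complex.exp (-(θ * Complex.I))] := by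
  simp only [hFun, qFacsInf, List.map_cons, List.map_nil, List.prod_cons, List.prod_nil, mul_one,
    qFacInf]
  rw [← (multipliable_qFacInf hq _).tprod_mul (multipliable_qFacInf hq _)]
  refine tprod_congr fun k => ?_
  have h1 : Complex.exp (θ * Complex.I) * Complex.exp (-(θ * Complex.I)) = 1 := by
    rw [← Complex.exp_add]; simp
  rw [Complex.ofReal_cos, Complex.cos, neg_mul, pow_mul']
  linear_combination (-(a ^ 2 * (q ^ k) ^ 2)) * h1

theorem vwpFactor_eq (q α : ℂ) (n : ℕ) :
    vwpFactor q α n =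
      if n = 0 then 1 else (1 - α * q ^ (2 * n)) * qFac q (α * q) (n - 1) := by
  unfold vwpFactor
  by_cases h : α = 1
  · simp [h]
  · have h' : (1 : ℂ) - α ≠ 0 := sub_ne_zero.mpr (Ne.symm h)
    rw [if_neg h]
    rcases n with _ | n
    · simp [qFac, h']
    · have e : qFac q α (n + 1) = (1 - α) * qFac q (α * q) n := by
        simp only [qFac]
        rw [Finset.prod_range_succ', mul_comm]
        simp [pow_succ', mul_assoc]
      rw [e]
      simp
      field_simp

/-- The `n`-th term of the series on the right-hand side of the integral evaluation. -/
def rhsTerm (q a b c d r s t h z β δ α : ℂ) (n : ℕ) : ℂ :=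
  vwpFactor q α n * qFacs q [a * b, a * c, a * d, a * r] n /
      qFacs q [q, a * b * c * d, a * b * c * r, a * b * d * r, a * c * d * r] n *
    (-(b * c * d * r)) ^ n * q ^ (n * (n - 1) / 2) *
    phi q [q ^ (-(n : ℤ)), α * q ^ n, β, δ] [s, t, h] (q * z)

/-- The integrand of the `q`-beta integral. -/
def lhsIntegrand (q a b c d r s t h z β δ : ℂ) (θ : ℝ) : ℂ :=
  hFuns q (Real.cos (2 * θ)) [1] / hFuns q (Real.cos θ) [a, b, c, d, r] *
    phi q [a * Complex.exp (θ * Complex.I), a * Complex.exp (-(θ * Complex.I)), β, δ] [s, t, h]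
      (b * c * d * r * z)

end QBeta

end

/-!
The proof reduces the claim to the case where the `₄φ₃` under the integral is `1`, and that case to
the Askey–Wilson integral.

*Contiguity.* Write `J(L)` for the integral of `h(cos 2θ; 1) / h(cos θ; L)`. Since
`h(x; a) = (1 - 2ax + a²) h(x; aq)`, the integral satisfies in any two of its parameters
`b J(aq, b) - a J(a, bq) = (b - a)(1 - ab) J(a, b)` (`betaIntegral_contiguous`). A function of
`(a, b)` that satisfies this relation, is analytic in `a` on the unit disc and vanishes for `a = 0`
is zero: the relation shows that the order of vanishing at `a = 0` exceeds every `n`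
(`eq_zero_of_functional_equation`). Hence `J` is determined by its values with one parameter zero.

*The Askey–Wilson integral.* The product `(abcd) / (ab, ac, ad, bc, bd, cd)` satisfies the same
relation, so the four-parameter integral reduces to `J(d)`, one parameter at a time. A contour
shift from `|z| = q^{-1/2}` to `|z| = q^{1/2}` gives `J(dq) = J(d)`, so `J(d) = J()`
(`betaIntegral_singleton`). The constant `J()` is found by evaluating the integral at
`(q^{1/2}, -q^{1/2}, q, -q)`, where the integrand is elementary (`betaIntegral_nil`).

*Five parameters.* The very-well-poised series on the right-hand side, times its product, satisfies
the contiguity relation in `b` and `c`: a rearrangement of the series turns the relation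
into a polynomial identity between terms (`tsum_wpTerm_contiguous`). For `b = 0` the series is `1`
and the product is that of the Askey–Wilson integral, whence `betaIntegral_five`.

*The general case.* Expand the `₄φ₃` under the integral. Its factors `(ae^{iθ}, ae^{-iθ}; q)_k`
change `h(cos θ; a)` into `h(cos θ; aq^k)`, so each term is a five-parameter integral, and gives a
very-well-poised series with `aq^k` for `a`. On the other side the inner `₄φ₃` terminates, and
`wpTerm_add_mul` identifies its terms with those of the same double series, now summed along
antidiagonals. The double series is dominated by a product of geometric series in `|bcdrz|` and
`|bcdr|`, both less than `1` even if `|z| = 1`.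
-/

namespace QBeta

open Filter Topology

/-! ### Shifted factorials -/

theorem summable_norm_mul_pow {q : ℂ} (hq : ‖q‖ < 1) (a : ℂ) :
    Summable fun k : ℕ => ‖-(a * q ^ k)‖ := by
  simp only [norm_neg, norm_mul, norm_pow]
  exact (summable_geometric_of_lt_one (norm_nonneg q) hq).mul_left _

theorem norm_mul_pow_lt_one {q a : ℂ} (hq : ‖q‖ < 1) (ha : ‖a‖ < 1) (k : ℕ) :
    ‖a * q ^ k‖ < 1 := by
  rw [norm_mul, norm_pow]
  exact mul_lt_one_of_nonneg_of_lt_one_left (norm_nonneg _) ha (pow_le_one₀ (norm_nonneg _) hq.le)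

theorem norm_mul_lt_one {a b : ℂ} (ha : ‖a‖ < 1) (hb : ‖b‖ < 1) : ‖a * b‖ < 1 := by
  rw [norm_mul]
  exact mul_lt_one_of_nonneg_of_lt_one_left (norm_nonneg _) ha hb.le

theorem one_sub_ne_zero {x : ℂ} (hx : ‖x‖ < 1) : 1 - x ≠ 0 := by
  intro h
  rw [← sub_eq_zero.mp h] at hx
  simp at hx

@[simp] theorem qFac_zero (q a : ℂ) : qFac q a 0 = 1 := by simp [qFac]

@[simp] theorem qFac_zero_left (q : ℂ) (n : ℕ) : qFac q 0 n = 1 := by simp [qFac]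

@[simp] theorem qFacInf_zero (q : ℂ) : qFacInf q 0 = 1 := by simp [qFacInf]

theorem qFac_succ (q a : ℂ) (n : ℕ) : qFac q a (n + 1) = qFac q a n * (1 - a * q ^ n) := by
  simp [qFac, Finset.prod_range_succ]

theorem qFac_succ' (q a : ℂ) (n : ℕ) : qFac q a (n + 1) = (1 - a) * qFac q (a * q) n := by
  simp only [qFac]
  rw [Finset.prod_range_succ', mul_comm]
  simp [pow_succ', mul_assoc]

theorem qFac_add (q a : ℂ) (m n : ℕ) :
    qFac q a (m + n) = qFac q a m * qFac q (a * q ^ m) n := by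
  simp only [qFac, Finset.prod_range_add, pow_add, mul_assoc]

theorem qFac_ne_zero {q a : ℂ} (hq : ‖q‖ < 1) (ha : ‖a‖ < 1) (n : ℕ) : qFac q a n ≠ 0 :=
  Finset.prod_ne_zero_iff.mpr fun k _ => one_sub_ne_zero (norm_mul_pow_lt_one hq ha k)

theorem qFacInf_ne_zero {q a : ℂ} (hq : ‖q‖ < 1) (ha : ‖a‖ < 1) : qFacInf q a ≠ 0 := by
  have := tprod_one_add_ne_zero_of_summable (f := fun k : ℕ => -(a * q ^ k))
    (fun k => by
      rw [← sub_eq_add_neg]; exact one_sub_ne_zero (norm_mul_pow_lt_one hq ha k))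
    (summable_norm_mul_pow hq a)
  simpa [qFacInf, sub_eq_add_neg] using this

theorem qFacInf_eq_qFac_mul {q : ℂ} (hq : ‖q‖ < 1) (a : ℂ) (n : ℕ) :
    qFacInf q a = qFac q a n * qFacInf q (a * q ^ n) := by
  have h := (multipliable_qFacInf hq a).hasProd.tendsto_prod_nat.comp (tendsto_add_atTop_nat n)
  have h2 := (multipliable_qFacInf hq (a * q ^ n)).hasProd.tendsto_prod_nat.const_mul (qFac q a n)
  refine tendsto_nhds_unique h (h2.congr fun m => ?_)
  have := qFac_add q a n m
  simp only [qFac] at this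
  simp only [Function.comp_apply]
  rw [add_comm m n, this]
  rfl

theorem qFacInf_eq_one_sub_mul {q : ℂ} (hq : ‖q‖ < 1) (a : ℂ) :
    qFacInf q a = (1 - a) * qFacInf q (a * q) := by
  simpa [qFac] using qFacInf_eq_qFac_mul hq a 1

theorem qFacInf_mul_pow {q a : ℂ} (hq : ‖q‖ < 1) (ha : ‖a‖ < 1) (n : ℕ) :
    qFacInf q (a * q ^ n) = qFacInf q a / qFac q a n := by
  rw [qFacInf_eq_qFac_mul hq a n, mul_div_cancel_left₀ _ (qFac_ne_zero hq ha n)]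

theorem qFacInf_mul {q a : ℂ} (hq : ‖q‖ < 1) (ha : ‖a‖ < 1) :
    qFacInf q (a * q) = qFacInf q a / (1 - a) := by
  rw [qFacInf_eq_one_sub_mul hq a, mul_div_cancel_left₀ _ (one_sub_ne_zero ha)]

theorem differentiable_qFac (q : ℂ) (n : ℕ) : Differentiable ℂ fun a => qFac q a n := by
  unfold qFac
  exact Differentiable.fun_finsetProd fun _ _ => by fun_prop

theorem differentiable_qFacInf {q : ℂ} (hq : ‖q‖ < 1) : Differentiable ℂ (qFacInf q) := by
  intro a
  have hu : Summable fun k : ℕ => (‖a‖ + 1) * ‖q‖ ^ k :=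
    (summable_geometric_of_lt_one (norm_nonneg q) hq).mul_left _
  have h := Summable.hasProdLocallyUniformlyOn_nat_one_add (R := ℂ)
    (f := fun (k : ℕ) (x : ℂ) => -(x * q ^ k)) (K := Metric.ball 0 (‖a‖ + 1)) Metric.isOpen_ball hu
    (.of_forall fun k x hx => by
      rw [norm_neg, norm_mul, norm_pow]
      have : ‖x‖ < ‖a‖ + 1 := by simpa using hx
      gcongr) (fun k => by fun_prop)
  have hd := h.differentiableOn
    (.of_forall fun s => by
      simpa [Finset.prod_fn] using DifferentiableOn.fun_finsetProd (fun _ _ => by fun_prop))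
    Metric.isOpen_ball
  have := hd.differentiableAt (Metric.isOpen_ball.mem_nhds (x := a) (by simp))
  have e : qFacInf q = fun x => ∏' k : ℕ, (1 + -(x * q ^ k)) := by
    funext x
    simp only [qFacInf, sub_eq_add_neg]
  rw [e]
  exact this

theorem continuous_qFacInf {q : ℂ} (hq : ‖q‖ < 1) : Continuous (qFacInf q) :=
  (differentiable_qFacInf hq).continuous

theorem sum_mul_pow_le {x ρ : ℝ} (hx0 : 0 ≤ x) (hx : x < 1) (hρ : 0 ≤ ρ) (n : ℕ) :
    ∑ k ∈ Finset.range n, ρ * x ^ k ≤ ρ * (1 - x)⁻¹ := by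
  rw [← Finset.mul_sum, ← tsum_geometric_of_lt_one hx0 hx]
  gcongr
  exact (summable_geometric_of_lt_one hx0 hx).sum_le_tsum _ fun k _ => by positivity

theorem exists_norm_qFac_le {q : ℂ} (hq : ‖q‖ < 1) (ρ : ℝ) :
    ∃ M : ℝ, 0 < M ∧ ∀ a : ℂ, ‖a‖ ≤ ρ → ∀ n, ‖qFac q a n‖ ≤ M := by
  refine ⟨Real.exp (ρ * (1 - ‖q‖)⁻¹), Real.exp_pos _, fun a ha n => ?_⟩
  have hρ : 0 ≤ ρ := (norm_nonneg a).trans ha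
  calc ‖qFac q a n‖ ≤ ∏ k ∈ Finset.range n, (1 + ρ * ‖q‖ ^ k) := by
        rw [qFac, norm_prod]
        refine Finset.prod_le_prod (fun _ _ => norm_nonneg _) fun k _ => ?_
        refine (norm_sub_le _ _).trans ?_
        rw [norm_one, norm_mul, norm_pow]
        gcongr
    _ ≤ Real.exp (∑ k ∈ Finset.range n, ρ * ‖q‖ ^ k) :=
        Real.prod_one_add_le_exp_sum _ fun k => by positivity
    _ ≤ _ := Real.exp_le_exp.mpr (sum_mul_pow_le (norm_nonneg q) hq hρ n)

/-- A lower bound for `(a; q)_n`, uniform in `n` and in `‖a‖ ≤ ρ`, stated for the inverse. -/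
theorem exists_norm_inv_qFac_le {q : ℂ} (hq : ‖q‖ < 1) {ρ : ℝ} (hρ1 : ρ < 1) :
    ∃ M : ℝ, 0 < M ∧ ∀ a : ℂ, ‖a‖ ≤ ρ → ∀ n, ‖(qFac q a n)⁻¹‖ ≤ M := by
  refine ⟨Real.exp (ρ / (1 - ρ) * (1 - ‖q‖)⁻¹), Real.exp_pos _, fun a ha n => ?_⟩
  have hρ : 0 ≤ ρ := (norm_nonneg a).trans ha
  have h1 : 0 < 1 - ρ := sub_pos.mpr hρ1
  have h2 : 0 ≤ ρ / (1 - ρ) := by positivity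
  calc ‖(qFac q a n)⁻¹‖ ≤ ∏ k ∈ Finset.range n, (1 + ρ / (1 - ρ) * ‖q‖ ^ k) := by
        rw [qFac, ← Finset.prod_inv_distrib, norm_prod]
        refine Finset.prod_le_prod (fun _ _ => norm_nonneg _) fun k _ => ?_
        have hk : ‖q‖ ^ k ≤ 1 := pow_le_one₀ (norm_nonneg _) hq.le
        have h0 : 0 ≤ ‖q‖ ^ k := by positivity
        have h3 : 1 - ρ * ‖q‖ ^ k ≤ ‖1 - a * q ^ k‖ := by
          have := norm_sub_norm_le (1 : ℂ) (a * q ^ k)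
          rw [norm_one, norm_mul, norm_pow] at this
          have h4 : ‖a‖ * ‖q‖ ^ k ≤ ρ * ‖q‖ ^ k := by gcongr
          linarith
        have h5 : 0 < 1 - ρ * ‖q‖ ^ k := by nlinarith
        rw [norm_inv]
        refine inv_le_of_inv_le₀ (by positivity) (le_trans ?_ h3)
        rw [inv_le_iff_one_le_mul₀' (by positivity)]
        -- `(1 + y / (1 - ρ)) * (1 - y) ≥ 1` for `0 ≤ y ≤ ρ`
        have h6 : (1 + ρ / (1 - ρ) * ‖q‖ ^ k) * (1 - ρ * ‖q‖ ^ k) =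
            1 + ρ / (1 - ρ) * ‖q‖ ^ k * (ρ * (1 - ‖q‖ ^ k)) := by
          field_simp
          ring
        rw [h6]
        have : 0 ≤ ρ / (1 - ρ) * ‖q‖ ^ k * (ρ * (1 - ‖q‖ ^ k)) :=
          mul_nonneg (by positivity) (mul_nonneg hρ (by linarith))
        linarith
    _ ≤ Real.exp (∑ k ∈ Finset.range n, ρ / (1 - ρ) * ‖q‖ ^ k) :=
        Real.prod_one_add_le_exp_sum _ fun k => by positivity
    _ ≤ _ := Real.exp_le_exp.mpr (sum_mul_pow_le (norm_nonneg q) hq h2 n)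

/-! ### Uniqueness for a two-parameter functional equation -/

/-- If `E 0 b = 0` and `E(·, b)` is analytic for every `b`, the contiguity relation forces `E` to
vanish: when every `E(·, b)` vanishes at `0` to order `n ≥ 1`, the coefficients of `a ^ n` in the
relation give `b (1 - q ^ n) e_n(b) = 0`, so that the order is at least `n + 1`. -/
theorem eq_zero_of_functional_equation {q : ℂ} (hq0 : q ≠ 0) (hq : ‖q‖ < 1) {E : ℂ → ℂ → ℂ}
    (hd : ∀ b, ‖b‖ < 1 → DifferentiableOn ℂ (fun a => E a b) (Metric.ball 0 1))
    (h0 : ∀ b, ‖b‖ < 1 → E 0 b = 0)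
    (hE : ∀ a b, ‖a‖ < 1 → ‖b‖ < 1 →
      b * E (a * q) b - a * E a (b * q) = (b - a) * (1 - a * b) * E a b)
    {a b : ℂ} (ha : ‖a‖ < 1) (hb : ‖b‖ < 1) (hb0 : b ≠ 0) : E a b = 0 := by
  have hball : ∀ᶠ x in 𝓝 (0 : ℂ), ‖x‖ < 1 := by
    filter_upwards [Metric.ball_mem_nhds (0 : ℂ) one_pos] with x hx using by simpa using hx
  have han : ∀ b, ‖b‖ < 1 → AnalyticAt ℂ (fun a => E a b) 0 := fun b hb =>
    (hd b hb).analyticAt (Metric.ball_mem_nhds _ one_pos)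
  have hqb : ∀ b : ℂ, ‖b‖ < 1 → ‖b * q‖ < 1 := fun b hb => norm_mul_lt_one hb hq
  have key : ∀ n : ℕ, ∀ b, ‖b‖ < 1 → b ≠ 0 →
      ((n + 1 : ℕ) : ℕ∞) ≤ analyticOrderAt (fun a => E a b) 0 := by
    intro n
    induction n with
    | zero =>
      intro b hb _
      have : analyticOrderAt (fun a => E a b) 0 ≠ 0 :=
        analyticOrderAt_ne_zero.mpr ⟨han b hb, h0 b hb⟩
      simpa using Order.one_le_iff_ne_zero.mpr this
    | succ n ih =>
      intro b hb hb0
      obtain ⟨g, hg, hgE⟩ := (natCast_le_analyticOrderAt (han b hb)).mp (ih b hb hb0)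
      obtain ⟨g', hg', hgE'⟩ := (natCast_le_analyticOrderAt (han _ (hqb b hb))).mp
        (ih (b * q) (hqb b hb) (mul_ne_zero hb0 hq0))
      simp only [sub_zero, smul_eq_mul] at hgE hgE'
      have htq : Tendsto (fun x : ℂ => x * q) (𝓝 0) (𝓝 0) := by
        have : Continuous fun x : ℂ => x * q := by fun_prop
        simpa using this.tendsto 0
      -- the functional equation, divided by the common power of `x`
      have heq : ∀ᶠ x in 𝓝[≠] (0 : ℂ), b * q ^ (n + 1) * g (x * q) - x * g' x =
          (b - x) * (1 - x * b) * g x := by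
        filter_upwards [nhdsWithin_le_nhds hgE, nhdsWithin_le_nhds hgE',
          nhdsWithin_le_nhds (htq.eventually hgE), nhdsWithin_le_nhds hball,
          self_mem_nhdsWithin] with x h1 h2 h3 h4 hx
        have hx' : x ^ (n + 1) ≠ 0 := pow_ne_zero _ hx
        have := hE x b h4 hb
        rw [h1, h2, h3] at this
        refine mul_left_cancel₀ hx' ?_
        rw [mul_pow] at this
        linear_combination this
      have hg0 : g 0 = 0 := by
        have c1 : Tendsto (fun x => b * q ^ (n + 1) * g (x * q) - x * g' x) (𝓝[≠] 0)
            (𝓝 (b * q ^ (n + 1) * g 0 - 0 * g' 0)) :=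
          (((hg.continuousAt.tendsto.comp htq).const_mul _).sub
            (tendsto_id.mul hg'.continuousAt.tendsto)).mono_left nhdsWithin_le_nhds
        have c2 : Tendsto (fun x => (b - x) * (1 - x * b) * g x) (𝓝[≠] 0)
            (𝓝 ((b - 0) * (1 - 0 * b) * g 0)) := by
          refine Tendsto.mono_left ?_ nhdsWithin_le_nhds
          have : Continuous fun x : ℂ => (b - x) * (1 - x * b) := by fun_prop
          exact (this.tendsto 0).mul hg.continuousAt.tendsto
        have h := tendsto_nhds_unique (c1.congr' heq) c2
        have hqn : (1 : ℂ) - q ^ (n + 1) ≠ 0 := one_sub_ne_zero (by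
          rw [norm_pow]; exact pow_lt_one₀ (norm_nonneg _) hq (by simp))
        have : b * ((1 - q ^ (n + 1)) * g 0) = 0 := by linear_combination -h
        simpa [hb0, hqn] using this
      have hgo : 1 ≤ analyticOrderAt g 0 := Order.one_le_iff_ne_zero.mpr
        (analyticOrderAt_ne_zero.mpr ⟨hg, hg0⟩)
      obtain ⟨k, hk, hkg⟩ := (natCast_le_analyticOrderAt (n := 1) hg).mp (by simpa using hgo)
      refine (natCast_le_analyticOrderAt (han b hb)).mpr ⟨k, hk, ?_⟩
      filter_upwards [hgE, hkg] with x h1 h2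
      rw [h1, h2]
      simp only [sub_zero, smul_eq_mul]
      ring
  have htop : analyticOrderAt (fun a => E a b) 0 = ⊤ :=
    ENat.eq_top_iff_forall_ge.mpr fun n => le_trans (by norm_cast; simp) (key n b hb hb0)
  have hA : AnalyticOnNhd ℂ (fun a => E a b) (Metric.ball 0 1) :=
    (hd b hb).analyticOnNhd Metric.isOpen_ball
  exact hA.eqOn_zero_of_preconnected_of_eventuallyEq_zero (convex_ball _ _).isPreconnected
    (Metric.mem_ball_self one_pos) (analyticOrderAt_eq_top.mp htop) (by simpa using ha)

/-! ### The weight and its integrals -/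

theorem hFun_cos_eq_mul {q : ℂ} (hq : ‖q‖ < 1) (a : ℂ) (θ : ℝ) :
    hFun q (Real.cos θ) a =
      qFacInf q (a * Complex.exp (θ * Complex.I)) *
        qFacInf q (a * Complex.exp (-(θ * Complex.I))) := by
  rw [hFun_cos hq]
  simp [qFacsInf]

theorem norm_exp_neg_ofReal_mul_I (θ : ℝ) : ‖Complex.exp (-(θ * Complex.I))‖ = 1 := by
  rw [Complex.exp_neg, norm_inv, Complex.norm_exp_ofReal_mul_I, inv_one]

theorem hFun_cos_ne_zero {q a : ℂ} (hq : ‖q‖ < 1) (ha : ‖a‖ < 1) (θ : ℝ) :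
    hFun q (Real.cos θ) a ≠ 0 := by
  rw [hFun_cos_eq_mul hq]
  refine mul_ne_zero (qFacInf_ne_zero hq ?_) (qFacInf_ne_zero hq ?_)
  · rwa [norm_mul, Complex.norm_exp_ofReal_mul_I, mul_one]
  · rwa [norm_mul, norm_exp_neg_ofReal_mul_I, mul_one]

theorem hFun_cos_eq_mul_hFun {q : ℂ} (hq : ‖q‖ < 1) (a : ℂ) (θ : ℝ) :
    hFun q (Real.cos θ) a =
      (1 - 2 * a * Real.cos θ + a ^ 2) * hFun q (Real.cos θ) (a * q) := by
  rw [hFun_cos_eq_mul hq, hFun_cos_eq_mul hq, qFacInf_eq_one_sub_mul hq,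
    qFacInf_eq_one_sub_mul hq (a * Complex.exp (-(θ * Complex.I)))]
  have h1 : Complex.exp (θ * Complex.I) * Complex.exp (-(θ * Complex.I)) = 1 := by
    rw [← Complex.exp_add]; simp
  have h2 : (1 - a * Complex.exp (θ * Complex.I)) * (1 - a * Complex.exp (-(θ * Complex.I))) =
      1 - 2 * a * Real.cos θ + a ^ 2 := by
    rw [Complex.ofReal_cos, Complex.cos, neg_mul]
    linear_combination a ^ 2 * h1
  rw [← h2]
  ring_nf

theorem hFun_zero (q : ℂ) (x : ℝ) : hFun q x 0 = 1 := by simp [hFun]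

theorem hFuns_cons (q : ℂ) (x : ℝ) (a : ℂ) (L : List ℂ) :
    hFuns q x (a :: L) = hFun q x a * hFuns q x L := by simp [hFuns]

theorem hFuns_nil (q : ℂ) (x : ℝ) : hFuns q x [] = 1 := by simp [hFuns]

theorem continuous_hFun_cos {q : ℂ} (hq : ‖q‖ < 1) (a : ℂ) :
    Continuous fun θ : ℝ => hFun q (Real.cos θ) a := by
  simp_rw [hFun_cos_eq_mul hq]
  have := continuous_qFacInf hq
  fun_prop

theorem continuous_hFuns_cos {q : ℂ} (hq : ‖q‖ < 1) (L : List ℂ) :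
    Continuous fun θ : ℝ => hFuns q (Real.cos θ) L := by
  induction L with
  | nil => simpa [hFuns_nil] using continuous_const
  | cons a L ih =>
    simp_rw [hFuns_cons]
    exact (continuous_hFun_cos hq a).mul ih

theorem hFuns_cos_ne_zero {q : ℂ} (hq : ‖q‖ < 1) {L : List ℂ} (hL : ∀ a ∈ L, ‖a‖ < 1) (θ : ℝ) :
    hFuns q (Real.cos θ) L ≠ 0 := by
  induction L with
  | nil => simp [hFuns_nil]
  | cons a L ih =>
    rw [hFuns_cons]
    exact mul_ne_zero (hFun_cos_ne_zero hq (hL a (by simp)) θ)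
      (ih fun x hx => hL x (by simp [hx]))

/-- The integrand `h(cos 2θ; 1 | q) / h(cos θ; L | q)` of the `q`-beta integral with the list `L`
of parameters. -/
noncomputable def betaIntegrand (q : ℂ) (L : List ℂ) (θ : ℝ) : ℂ :=
  hFuns q (Real.cos (2 * θ)) [1] / hFuns q (Real.cos θ) L

/-- The `q`-beta integral `∫_0^π h(cos 2θ; 1 | q) / h(cos θ; L | q) dθ` with the list `L` of
parameters; the Askey–Wilson integral is the case of four parameters. -/
noncomputable def betaIntegral (q : ℂ) (L : List ℂ) : ℂ :=
  ∫ θ in (0 : ℝ)..Real.pi, betaIntegrand q L θ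

theorem continuous_betaIntegrand {q : ℂ} (hq : ‖q‖ < 1) {L : List ℂ} (hL : ∀ a ∈ L, ‖a‖ < 1) :
    Continuous (betaIntegrand q L) :=
  ((continuous_hFuns_cos hq [1]).comp (by fun_prop)).div (continuous_hFuns_cos hq L)
    (hFuns_cos_ne_zero hq hL)

theorem betaIntegral_perm (q : ℂ) {L L' : List ℂ} (h : L.Perm L') :
    betaIntegral q L = betaIntegral q L' := by
  have : ∀ x, hFuns q x L = hFuns q x L' := fun x => (h.map _).prod_eq
  simp only [betaIntegral, betaIntegrand, this]

theorem betaIntegral_zero_cons (q : ℂ) (L : List ℂ) :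
    betaIntegral q (0 :: L) = betaIntegral q L := by
  simp only [betaIntegral, betaIntegrand, hFuns_cons q _ 0, hFun_zero, one_mul]

theorem betaIntegrand_mul_cons {q : ℂ} (hq : ‖q‖ < 1) {a : ℂ} (ha : ‖a‖ < 1) (L : List ℂ) (θ : ℝ) :
    betaIntegrand q (a * q :: L) θ =
      (1 - 2 * a * Real.cos θ + a ^ 2) * betaIntegrand q (a :: L) θ := by
  have h := hFun_cos_eq_mul_hFun hq a θ
  have h0 := hFun_cos_ne_zero hq ha θ
  rw [h] at h0
  simp only [betaIntegrand, hFuns_cons q _ a, hFuns_cons q _ (a * q), h]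
  rw [mul_assoc (1 - 2 * a * (Real.cos θ : ℂ) + a ^ 2), ← mul_div_assoc,
    mul_div_mul_left _ _ (left_ne_zero_of_mul h0)]

theorem forall_mem_cons_norm_lt {a : ℂ} {L : List ℂ} (ha : ‖a‖ < 1) (hL : ∀ x ∈ L, ‖x‖ < 1) :
    ∀ x ∈ a :: L, ‖x‖ < 1 := by
  simpa using ⟨ha, hL⟩

/-- The contiguity relation in two of the parameters. It holds because
`b (1 - 2 a x + a²) - a (1 - 2 b x + b²) = (b - a) (1 - a b)`. -/
theorem betaIntegral_contiguous {q : ℂ} (hq : ‖q‖ < 1) {a b : ℂ} (ha : ‖a‖ < 1) (hb : ‖b‖ < 1)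
    {L : List ℂ} (hL : ∀ x ∈ L, ‖x‖ < 1) :
    b * betaIntegral q (a * q :: b :: L) - a * betaIntegral q (a :: b * q :: L) =
      (b - a) * (1 - a * b) * betaIntegral q (a :: b :: L) := by
  rw [betaIntegral_perm q (List.Perm.swap (b * q) a L)]
  have haq : ‖a * q‖ < 1 := norm_mul_lt_one ha hq
  have hbq : ‖b * q‖ < 1 := norm_mul_lt_one hb hq
  have c1 := continuous_betaIntegrand hq
    (forall_mem_cons_norm_lt haq (forall_mem_cons_norm_lt hb hL))
  have c2 := continuous_betaIntegrand hq
    (forall_mem_cons_norm_lt hbq (forall_mem_cons_norm_lt ha hL))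
  unfold betaIntegral
  rw [← intervalIntegral.integral_const_mul, ← intervalIntegral.integral_const_mul,
    ← intervalIntegral.integral_const_mul, ← intervalIntegral.integral_sub
      ((c1.const_mul _).intervalIntegrable _ _) ((c2.const_mul _).intervalIntegrable _ _)]
  congr 1
  funext θ
  have hs : betaIntegrand q (b :: a :: L) θ = betaIntegrand q (a :: b :: L) θ := by
    simp only [betaIntegrand, hFuns_cons, mul_left_comm]
  rw [betaIntegrand_mul_cons hq ha, betaIntegrand_mul_cons hq hb, hs]
  ring

/-- Differentiation under the integral sign for a jointly continuous derivative. -/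
theorem differentiableOn_intervalIntegral {F F' : ℂ → ℝ → ℂ} {U : Set ℂ} (hU : IsOpen U)
    (hF : ∀ a ∈ U, Continuous (F a)) (hF' : ContinuousOn (Function.uncurry F') (U ×ˢ Set.univ))
    (hd : ∀ a ∈ U, ∀ θ, HasDerivAt (fun x => F x θ) (F' a θ) a) (x y : ℝ) :
    DifferentiableOn ℂ (fun a => ∫ θ in x..y, F a θ) U := by
  intro a ha
  obtain ⟨ε, hε, hεU⟩ := Metric.nhds_basis_closedBall.mem_iff.mp (hU.mem_nhds ha)
  have hK : IsCompact (Metric.closedBall a ε ×ˢ Set.uIcc x y) :=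
    (isCompact_closedBall _ _).prod isCompact_uIcc
  obtain ⟨M, hM⟩ := hK.exists_bound_of_continuousOn
    (hF'.mono (Set.prod_mono hεU (Set.subset_univ _)))
  have hc : Continuous (F' a) :=
    hF'.comp_continuous (f := fun θ : ℝ => (a, θ)) (by fun_prop) fun θ => ⟨ha, trivial⟩
  refine (intervalIntegral.hasDerivAt_integral_of_dominated_loc_of_deriv_le (F' := F')
    (bound := fun _ => M) (Metric.closedBall_mem_nhds a hε) ?_ ((hF a ha).intervalIntegrable _ _)
    hc.aestronglyMeasurable ?_ intervalIntegrable_const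
    (.of_forall fun θ _ z hz => hd z (hεU hz) θ)).2.differentiableAt.differentiableWithinAt
  · filter_upwards [hU.mem_nhds ha] with z hz using (hF z hz).aestronglyMeasurable
  · exact .of_forall fun θ hθ z hz => hM (z, θ) ⟨hz, Set.uIoc_subset_uIcc hθ⟩

theorem differentiableOn_betaIntegral {q : ℂ} (hq : ‖q‖ < 1) {L : List ℂ}
    (hL : ∀ x ∈ L, ‖x‖ < 1) :
    DifferentiableOn ℂ (fun a => betaIntegral q (a :: L)) (Metric.ball 0 1) := by
  have hQ := differentiable_qFacInf hq
  have hQ' : Continuous (deriv (qFacInf q)) :=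
    (hQ.contDiff (n := 1)).continuous_deriv le_rfl
  have hQc := hQ.continuous
  have hLc := continuous_betaIntegrand hq hL
  have e : ∀ a θ, betaIntegrand q (a :: L) θ =
      betaIntegrand q L θ / (qFacInf q (a * Complex.exp (θ * Complex.I)) *
        qFacInf q (a * Complex.exp (-(θ * Complex.I)))) := by
    intro a θ
    rw [← hFun_cos_eq_mul hq, betaIntegrand, hFuns_cons q _ a, betaIntegrand, div_div,
      mul_comm (hFun _ _ _)]
  have h0 : ∀ a : ℂ, a ∈ Metric.ball (0 : ℂ) 1 → ∀ θ : ℝ,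
      qFacInf q (a * Complex.exp (θ * Complex.I)) *
        qFacInf q (a * Complex.exp (-(θ * Complex.I))) ≠ 0 := by
    intro a ha θ
    rw [← hFun_cos_eq_mul hq]
    exact hFun_cos_ne_zero hq (by simpa using ha) θ
  have hdQ : ∀ (u a : ℂ), HasDerivAt (fun x => qFacInf q (x * u))
      (deriv (qFacInf q) (a * u) * u) a := fun u a => by
    have := (hQ (a * u)).hasDerivAt.comp a ((hasDerivAt_id a).mul_const u)
    rwa [one_mul] at this
  refine differentiableOn_intervalIntegral Metric.isOpen_ball
    (F' := fun a θ => betaIntegrand q L θ *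
      (-(deriv (qFacInf q) (a * Complex.exp (θ * Complex.I)) * Complex.exp (θ * Complex.I) *
          qFacInf q (a * Complex.exp (-(θ * Complex.I))) +
        qFacInf q (a * Complex.exp (θ * Complex.I)) *
          (deriv (qFacInf q) (a * Complex.exp (-(θ * Complex.I))) *
            Complex.exp (-(θ * Complex.I)))) /
      (qFacInf q (a * Complex.exp (θ * Complex.I)) *
        qFacInf q (a * Complex.exp (-(θ * Complex.I)))) ^ 2)) ?_ ?_ ?_ _ _
  · intro a ha
    exact continuous_betaIntegrand hq (forall_mem_cons_norm_lt (by simpa using ha) hL)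
  · refine ContinuousOn.mul ?_ (ContinuousOn.div ?_ ?_ ?_)
    · exact (hLc.comp continuous_snd).continuousOn
    · exact Continuous.continuousOn (by fun_prop)
    · exact Continuous.continuousOn (by fun_prop)
    · rintro ⟨a, θ⟩ ⟨ha, -⟩
      exact pow_ne_zero 2 (h0 a ha θ)
  · intro a ha θ
    simp only [e, div_eq_mul_inv (betaIntegrand q L θ)]
    exact (((hdQ _ a).mul (hdQ _ a)).inv (h0 a ha θ)).const_mul _

/-! ### A contour shift: the one-parameter integral is constant -/

/-- Cauchy's theorem on an annulus, for the mean values over its two boundary circles. -/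
theorem integral_scaled_circle_eq {f : ℂ → ℂ} {r R : ℝ} (hr : 0 < r) (hrR : r ≤ R)
    (hf : ∀ z, r ≤ ‖z‖ → ‖z‖ ≤ R → DifferentiableAt ℂ f z) :
    ∫ θ in (0 : ℝ)..2 * Real.pi, f (R * Complex.exp (θ * Complex.I)) =
      ∫ θ in (0 : ℝ)..2 * Real.pi, f (r * Complex.exp (θ * Complex.I)) := by
  have h := Complex.circleIntegral_sub_center_inv_smul_eq_of_differentiable_on_annulus_off_countable
    (c := 0) hr hrR (f := f) (s := ∅) Set.countable_empty
    (fun z hz => (hf z (by simpa using hz.2) (by simpa using hz.1)).continuousAt.continuousWithinAt)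
    (fun z hz => hf z (le_of_lt (by simpa using hz.1.2)) (le_of_lt (by simpa using hz.1.1)))
  have key : ∀ S : ℝ, 0 < S → (∮ z in C(0, S), (z - 0)⁻¹ • f z) =
      Complex.I * ∫ θ in (0 : ℝ)..2 * Real.pi, f (S * Complex.exp (θ * Complex.I)) := by
    intro S hS
    rw [circleIntegral, ← intervalIntegral.integral_const_mul]
    congr 1
    funext θ
    have hne : circleMap 0 S θ ≠ 0 := circleMap_ne_center hS.ne'
    simp only [deriv_circleMap, sub_zero, smul_eq_mul]
    rw [← circleMap_zero]
    field_simp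
  rw [key R (hr.trans_le hrR), key r hr] at h
  exact mul_left_cancel₀ Complex.I_ne_zero h

theorem intervalIntegral_two_pi_eq_two_mul {g : ℝ → ℂ} (hg : Continuous g)
    (hs : ∀ θ, g (2 * Real.pi - θ) = g θ) :
    ∫ θ in (0 : ℝ)..2 * Real.pi, g θ = 2 * ∫ θ in (0 : ℝ)..Real.pi, g θ := by
  rw [← intervalIntegral.integral_add_adjacent_intervals (b := Real.pi)
    (hg.intervalIntegrable _ _) (hg.intervalIntegrable _ _),
    two_mul (∫ θ in (0 : ℝ)..Real.pi, g θ)]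
  congr 1
  have := intervalIntegral.integral_comp_sub_left (a := 0) (b := Real.pi) g (2 * Real.pi)
  rw [show 2 * Real.pi - Real.pi = Real.pi by ring, sub_zero] at this
  simp only [← this, hs]

/-- The function `(z - z⁻¹) (q z², q z⁻²; q)_∞ / (d p z, d p z⁻¹; q)_∞` with `p = q^{1/2}`, whose
integrals over the circles of radii `p` and `p⁻¹` agree. -/
noncomputable def shiftKernel (q d p z : ℂ) : ℂ :=
  (z - z⁻¹) * (qFacInf q (q * z ^ 2) * qFacInf q (q * (z⁻¹) ^ 2)) /
    (qFacInf q (d * p * z) * qFacInf q (d * p * z⁻¹))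

/-- On the unit circle, the difference of the two shifted kernels is a multiple of
`(2 cos θ - d) h(cos 2θ; 1) / h(cos θ; d)`. -/
theorem shiftKernel_sub {q d p e : ℂ} (hq : ‖q‖ < 1) (hp : p ^ 2 = q) (hp0 : p ≠ 0)
    (hd : ‖d‖ < 1) (he : ‖e‖ = 1) :
    shiftKernel q d p (p⁻¹ * e) - shiftKernel q d p (p * e) =
      p⁻¹ * ((e + e⁻¹ - d) * (qFacInf q (e ^ 2) * qFacInf q ((e⁻¹) ^ 2) /
        (qFacInf q (d * e) * qFacInf q (d * e⁻¹)))) := by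
  have he0 : e ≠ 0 := by
    rintro rfl
    simp at he
  have hei : ‖e⁻¹‖ = 1 := by rw [norm_inv, he, inv_one]
  have n1 : ‖d * e‖ < 1 := by rwa [norm_mul, he, mul_one]
  have n2 : ‖d * e⁻¹‖ < 1 := by rwa [norm_mul, hei, mul_one]
  have n3 : ‖q * e ^ 2‖ < 1 := by rwa [norm_mul, norm_pow, he, one_pow, mul_one]
  have n4 : ‖q * (e⁻¹) ^ 2‖ < 1 := by rwa [norm_mul, norm_pow, hei, one_pow, mul_one]
  -- everything is expressed by the values at `q e²`, `q e⁻²`, `d e` and `d e⁻¹`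
  have a1 := qFacInf_eq_one_sub_mul hq (e ^ 2)
  have a2 := qFacInf_eq_one_sub_mul hq ((e⁻¹) ^ 2)
  have a3 := qFacInf_mul hq n3
  have a4 := qFacInf_mul hq n4
  have a5 := qFacInf_mul hq n1
  have a6 := qFacInf_mul hq n2
  have z1 := qFacInf_ne_zero hq n1
  have z2 := qFacInf_ne_zero hq n2
  have y1 := one_sub_ne_zero n1
  have y2 := one_sub_ne_zero n2
  have y3 := one_sub_ne_zero n3
  have y4 := one_sub_ne_zero n4
  have b1 : q * (p⁻¹ * e) ^ 2 = e ^ 2 := by rw [← hp]; field_simp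
  have b2 : q * ((p⁻¹ * e)⁻¹) ^ 2 = q * (e⁻¹) ^ 2 * q := by rw [← hp]; field_simp
  have b3 : q * (p * e) ^ 2 = q * e ^ 2 * q := by rw [← hp]; ring
  have b4 : q * ((p * e)⁻¹) ^ 2 = (e⁻¹) ^ 2 := by rw [← hp]; field_simp
  have b5 : d * p * (p⁻¹ * e) = d * e := by field_simp
  have b6 : d * p * (p⁻¹ * e)⁻¹ = d * e⁻¹ * q := by rw [← hp]; field_simp
  have b7 : d * p * (p * e) = d * e * q := by rw [← hp]; ring
  have b8 : d * p * (p * e)⁻¹ = d * e⁻¹ := by field_simp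
  rw [shiftKernel, shiftKernel, b1, b2, b3, b4, b5, b6, b7, b8, a1, a2, a3, a4, a5, a6,
    mul_comm (e ^ 2) q, mul_comm ((e⁻¹) ^ 2) q]
  generalize qFacInf q (q * e ^ 2) = A
  generalize qFacInf q (q * (e⁻¹) ^ 2) = B
  generalize qFacInf q (d * e) = X at *
  generalize qFacInf q (d * e⁻¹) = Y at *
  have c1 : p⁻¹ * e - (p⁻¹ * e)⁻¹ = p⁻¹ * e * (1 - q * (e⁻¹) ^ 2) := by rw [← hp]; field_simp
  have c2 : p * e - (p * e)⁻¹ = -(p⁻¹ * e⁻¹ * (1 - q * e ^ 2)) := by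
    rw [← hp]; field_simp; ring
  have c3 : ∀ U V E : ℂ, U ≠ 0 → V ≠ 0 →
      p⁻¹ * e * U * (E * A * (B / U)) / (X * (Y / V)) =
      p⁻¹ * (e * E * V) * (A * B / (X * Y)) := by
    intros
    field_simp
  have c4 : ∀ U V E : ℂ, U ≠ 0 → V ≠ 0 →
      -(p⁻¹ * e⁻¹ * U) * (A / U * (E * B)) / (X / V * Y) =
      -(p⁻¹ * (e⁻¹ * E * V) * (A * B / (X * Y))) := by
    intros
    field_simp
  rw [c1, c2, c3 _ _ _ y4 y2, c4 _ _ _ y3 y1]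
  have c5 : e * e⁻¹ = 1 := mul_inv_cancel₀ he0
  generalize e⁻¹ = f at *
  have c6 : e * (1 - e ^ 2) * (1 - d * f) + f * (1 - f ^ 2) * (1 - d * e) =
      (e + f - d) * ((1 - e ^ 2) * (1 - f ^ 2)) := by
    linear_combination (d * e ^ 2 + d * f ^ 2 - 2 * d + d * (e * f + 1) - e * f * (e + f))
      * c5
  linear_combination p⁻¹ * (A * B / (X * Y)) * c6

theorem integral_weight_mul_sub_eq_zero {q : ℝ} (hq0 : 0 < q) (hq1 : q < 1) {d : ℂ}
    (hd : ‖d‖ < 1) :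
    ∫ θ in (0 : ℝ)..Real.pi, (2 * Real.cos θ - d) * betaIntegrand q [d] θ = 0 := by
  have hq : ‖(q : ℂ)‖ < 1 := by simpa [abs_of_pos hq0] using hq1
  set p : ℝ := Real.sqrt q with hp
  have hp0 : 0 < p := Real.sqrt_pos.mpr hq0
  have hp2 : p ^ 2 = q := Real.sq_sqrt hq0.le
  have hp1 : p < 1 := by nlinarith
  have hpc : (p : ℂ) ^ 2 = q := by exact_mod_cast hp2
  have hpc0 : (p : ℂ) ≠ 0 := by exact_mod_cast hp0.ne'
  set g : ℝ → ℂ := fun θ => (2 * Real.cos θ - d) * betaIntegrand q [d] θ with hg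
  have hgc : Continuous g := by
    have := continuous_betaIntegrand hq (L := [d]) (by simpa using hd)
    fun_prop
  have hshift : ∀ θ : ℝ, shiftKernel q d p ((p⁻¹ : ℝ) * Complex.exp (θ * Complex.I)) -
      shiftKernel q d p (p * Complex.exp (θ * Complex.I)) = (p : ℂ)⁻¹ * g θ := by
    intro θ
    rw [Complex.ofReal_inv, shiftKernel_sub hq hpc hpc0 hd (Complex.norm_exp_ofReal_mul_I θ)]
    have e1 : Complex.exp (θ * Complex.I) + (Complex.exp (θ * Complex.I))⁻¹ = 2 * Real.cos θ := by
      rw [← Complex.exp_neg, Complex.ofReal_cos, Complex.cos, neg_mul]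
      ring
    have e2 : Complex.exp (θ * Complex.I) ^ 2 = 1 * Complex.exp ((2 * θ : ℝ) * Complex.I) := by
      rw [← Complex.exp_nat_mul]; push_cast; ring_nf
    have e3 : (Complex.exp (θ * Complex.I))⁻¹ ^ 2 =
        1 * Complex.exp (-((2 * θ : ℝ) * Complex.I)) := by
      rw [← Complex.exp_neg, ← Complex.exp_nat_mul]; push_cast; ring_nf
    rw [e1, e2, e3, ← hFun_cos_eq_mul hq, ← Complex.exp_neg, ← hFun_cos_eq_mul hq]
    simp only [hg, betaIntegrand, hFuns_cons, hFuns_nil, mul_one]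
  have hdiff : ∀ z : ℂ, p ≤ ‖z‖ → ‖z‖ ≤ p⁻¹ → DifferentiableAt ℂ (shiftKernel q d p) z := by
    intro z h1 h2
    have hz : z ≠ 0 := norm_pos_iff.mp (hp0.trans_le h1)
    have hn1 : ‖d * p * z‖ < 1 := by
      rw [mul_assoc, norm_mul, norm_mul, Complex.norm_real, Real.norm_of_nonneg hp0.le]
      refine mul_lt_one_of_nonneg_of_lt_one_left (norm_nonneg _) hd ?_
      calc p * ‖z‖ ≤ p * p⁻¹ := by gcongr
        _ = 1 := mul_inv_cancel₀ hp0.ne'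
    have hn2 : ‖d * p * z⁻¹‖ < 1 := by
      rw [mul_assoc, norm_mul, norm_mul, Complex.norm_real, Real.norm_of_nonneg hp0.le, norm_inv]
      refine mul_lt_one_of_nonneg_of_lt_one_left (norm_nonneg _) hd ?_
      rw [← div_eq_mul_inv]
      exact div_le_one_of_le₀ h1 (norm_nonneg _)
    have hQ := differentiable_qFacInf hq
    have hi : DifferentiableAt ℂ (fun z : ℂ => z⁻¹) z := differentiableAt_inv hz
    have hc : ∀ u : ℂ → ℂ, DifferentiableAt ℂ u z →
        DifferentiableAt ℂ (fun z => qFacInf q (u z)) z := fun u hu => (hQ (u z)).comp z hu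
    exact ((differentiableAt_id.sub hi).mul ((hc _ (by fun_prop)).mul
      (hc _ ((hi.pow 2).const_mul _)))).div
      ((hc _ (by fun_prop)).mul (hc _ (hi.const_mul _)))
      (mul_ne_zero (qFacInf_ne_zero hq hn1) (qFacInf_ne_zero hq hn2))
  have hcirc := integral_scaled_circle_eq hp0
    (hp1.le.trans (one_le_inv_iff₀.mpr ⟨hp0, hp1.le⟩)) hdiff
  have hcont : ∀ R : ℝ, p ≤ R → R ≤ p⁻¹ →
      Continuous fun θ : ℝ => shiftKernel q d p (R * Complex.exp (θ * Complex.I)) := by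
    intro R h1 h2
    refine continuous_iff_continuousAt.mpr fun θ => ?_
    have hn : ‖(R : ℂ) * Complex.exp (θ * Complex.I)‖ = R := by
      rw [norm_mul, Complex.norm_exp_ofReal_mul_I, Complex.norm_real,
        Real.norm_of_nonneg (hp0.le.trans h1), mul_one]
    exact ContinuousAt.comp (f := fun θ : ℝ => (R : ℂ) * Complex.exp (θ * Complex.I))
      (hdiff _ (by rwa [hn]) (by rwa [hn])).continuousAt
      (by fun_prop)
  have hpp : p ≤ p⁻¹ := hp1.le.trans (one_le_inv_iff₀.mpr ⟨hp0, hp1.le⟩)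
  have hzero : ∫ θ in (0 : ℝ)..2 * Real.pi, (p : ℂ)⁻¹ * g θ = 0 := by
    simp only [← hshift]
    rw [intervalIntegral.integral_sub ((hcont _ hpp le_rfl).intervalIntegrable _ _)
      ((hcont _ le_rfl hpp).intervalIntegrable _ _), hcirc, sub_self]
  rw [intervalIntegral.integral_const_mul, intervalIntegral_two_pi_eq_two_mul hgc] at hzero
  · simpa [hpc0] using hzero
  · intro θ
    have c1 : Real.cos (2 * Real.pi - θ) = Real.cos θ := Real.cos_two_pi_sub θ
    have c2 : Real.cos (2 * (2 * Real.pi - θ)) = Real.cos (2 * θ) := by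
      rw [show 2 * (2 * Real.pi - θ) = -(2 * θ) + (2 : ℕ) * (2 * Real.pi) by push_cast; ring,
        Real.cos_add_nat_mul_two_pi, Real.cos_neg]
    simp only [hg, betaIntegrand, c1, c2]

theorem betaIntegral_singleton {q : ℝ} (hq0 : 0 < q) (hq1 : q < 1) {d : ℂ} (hd : ‖d‖ < 1) :
    betaIntegral q [d] = betaIntegral q [] := by
  have hq : ‖(q : ℂ)‖ < 1 := by simpa [abs_of_pos hq0] using hq1
  -- `1 - 2 d x + d² = 1 - d (2 x - d)`, so that replacing `d` by `d q` changes nothing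
  have step : ∀ d : ℂ, ‖d‖ < 1 → betaIntegral q [d * q] = betaIntegral q [d] := by
    intro d hd
    have hc := continuous_betaIntegrand hq (L := [d]) (by simpa using hd)
    have h : ∀ θ, betaIntegrand q [d * q] θ =
        betaIntegrand q [d] θ - d * ((2 * Real.cos θ - d) * betaIntegrand q [d] θ) := fun θ => by
      rw [betaIntegrand_mul_cons hq hd]
      ring
    have hc' : Continuous fun θ : ℝ => d * ((2 * Real.cos θ - d) * betaIntegrand q [d] θ) := by
      fun_prop
    unfold betaIntegral
    simp only [h]
    rw [intervalIntegral.integral_sub (hc.intervalIntegrable _ _) (hc'.intervalIntegrable _ _),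
      intervalIntegral.integral_const_mul, integral_weight_mul_sub_eq_zero hq0 hq1 hd, mul_zero,
      sub_zero]
  have hn : ∀ n : ℕ, betaIntegral q [d * q ^ n] = betaIntegral q [d] := by
    intro n
    induction n with
    | zero => simp
    | succ n ih => rw [← ih, pow_succ, ← mul_assoc, step _ (norm_mul_pow_lt_one hq hd n)]
  have hcont : ContinuousAt (fun a => betaIntegral q [a]) 0 :=
    ((differentiableOn_betaIntegral hq (L := []) (by simp)).differentiableAt
      (Metric.ball_mem_nhds _ one_pos)).continuousAt
  have hlim : Tendsto (fun n : ℕ => d * (q : ℂ) ^ n) atTop (𝓝 0) := by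
    simpa using (tendsto_pow_atTop_nhds_zero_of_norm_lt_one hq).const_mul d
  have := hcont.tendsto.comp hlim
  simp only [betaIntegral_zero_cons] at this
  exact tendsto_nhds_unique (tendsto_const_nhds.congr fun n => (hn n).symm) this

/-! ### The Askey–Wilson integral -/

/-- The Askey–Wilson product `(abcd; q)_∞ / (ab, ac, ad, bc, bd, cd; q)_∞`. -/
noncomputable def askeyWilsonProd (q a b c d : ℂ) : ℂ :=
  qFacInf q (a * b * c * d) / (qFacInf q (a * b) * qFacInf q (a * c) * qFacInf q (a * d) *
    qFacInf q (b * c) * qFacInf q (b * d) * qFacInf q (c * d))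

theorem askeyWilsonProd_contiguous {q a b c d : ℂ} (hq : ‖q‖ < 1) (ha : ‖a‖ < 1) (hb : ‖b‖ < 1)
    (hc : ‖c‖ < 1) (hd : ‖d‖ < 1) :
    b * askeyWilsonProd q (a * q) b c d - a * askeyWilsonProd q a (b * q) c d =
      (b - a) * (1 - a * b) * askeyWilsonProd q a b c d := by
  have hab := norm_mul_lt_one ha hb
  have hac := norm_mul_lt_one ha hc
  have had := norm_mul_lt_one ha hd
  have hbc := norm_mul_lt_one hb hc
  have hbd := norm_mul_lt_one hb hd
  have habcd := norm_mul_lt_one (norm_mul_lt_one hab hc) hd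
  simp only [askeyWilsonProd]
  rw [show a * q * b * c * d = a * b * c * d * q by ring,
    show a * (b * q) * c * d = a * b * c * d * q by ring, show a * q * b = a * b * q by ring,
    show a * (b * q) = a * b * q by ring, show a * q * c = a * c * q by ring,
    show a * q * d = a * d * q by ring, show b * q * c = b * c * q by ring,
    show b * q * d = b * d * q by ring, qFacInf_mul hq habcd, qFacInf_mul hq hab,
    qFacInf_mul hq hac, qFacInf_mul hq had, qFacInf_mul hq hbc, qFacInf_mul hq hbd]
  have z1 := qFacInf_ne_zero hq hab
  have z2 := qFacInf_ne_zero hq hac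
  have z3 := qFacInf_ne_zero hq had
  have z4 := qFacInf_ne_zero hq hbc
  have z5 := qFacInf_ne_zero hq hbd
  have z6 := qFacInf_ne_zero hq (norm_mul_lt_one hc hd)
  have y1 := one_sub_ne_zero hab
  have y2 := one_sub_ne_zero hac
  have y3 := one_sub_ne_zero had
  have y4 := one_sub_ne_zero hbc
  have y5 := one_sub_ne_zero hbd
  have y6 := one_sub_ne_zero habcd
  have key : ∀ N A B C D E F u v w x y t : ℂ, A ≠ 0 → B ≠ 0 → C ≠ 0 → D ≠ 0 → E ≠ 0 → F ≠ 0 →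
      u ≠ 0 → v ≠ 0 → w ≠ 0 → x ≠ 0 → y ≠ 0 → t ≠ 0 → b * (v * w) - a * (x * y) = (b - a) * t →
      b * (N / t / (A / u * (B / v) * (C / w) * D * E * F)) -
        a * (N / t / (A / u * B * C * (D / x) * (E / y) * F)) =
      (b - a) * u * (N / (A * B * C * D * E * F)) := by
    intro N A B C D E F u v w x y t hA hB hC hD hE hF hu hv hw hx hy ht h
    field_simp
    linear_combination N * h
  exact key _ _ _ _ _ _ _ _ _ _ _ _ _ z1 z2 z3 z4 z5 z6 y1 y2 y3 y4 y5 y6 (by ring)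

theorem differentiableOn_askeyWilsonProd {q b c d : ℂ} (hq : ‖q‖ < 1) (hb : ‖b‖ < 1)
    (hc : ‖c‖ < 1) (hd : ‖d‖ < 1) :
    DifferentiableOn ℂ (fun a => askeyWilsonProd q a b c d) (Metric.ball 0 1) := by
  intro a ha
  have ha : ‖a‖ < 1 := by simpa using ha
  have hQ := differentiable_qFacInf hq
  have hm : ∀ u : ℂ → ℂ, Differentiable ℂ u → Differentiable ℂ fun z => qFacInf q (u z) :=
    fun u hu => hQ.comp hu
  refine DifferentiableAt.differentiableWithinAt (DifferentiableAt.div ?_ ?_ ?_)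
  · exact hm (fun a => a * b * c * d) (by fun_prop) a
  · have h1 := hm (fun a => a * b) (by fun_prop)
    have h2 := hm (fun a => a * c) (by fun_prop)
    have h3 := hm (fun a => a * d) (by fun_prop)
    fun_prop
  · have z1 := qFacInf_ne_zero hq (norm_mul_lt_one ha hb)
    have z2 := qFacInf_ne_zero hq (norm_mul_lt_one ha hc)
    have z3 := qFacInf_ne_zero hq (norm_mul_lt_one ha hd)
    have z4 := qFacInf_ne_zero hq (norm_mul_lt_one hb hc)
    have z5 := qFacInf_ne_zero hq (norm_mul_lt_one hb hd)
    have z6 := qFacInf_ne_zero hq (norm_mul_lt_one hc hd)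
    positivity

/-- If the Askey–Wilson formula, up to the constant `K`, holds for vanishing first parameter, then
it always holds. -/
theorem betaIntegral_eq_askeyWilsonProd_of_zero {q : ℂ} (hq0 : q ≠ 0) (hq : ‖q‖ < 1) {K c d : ℂ}
    (hc : ‖c‖ < 1) (hd : ‖d‖ < 1)
    (h0 : ∀ b, ‖b‖ < 1 → betaIntegral q [0, b, c, d] = K * askeyWilsonProd q 0 b c d)
    {a b : ℂ} (ha : ‖a‖ < 1) (hb : ‖b‖ < 1) :
    betaIntegral q [a, b, c, d] = K * askeyWilsonProd q a b c d := by
  rcases eq_or_ne b 0 with rfl | hb0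
  · rw [betaIntegral_perm q (List.Perm.swap 0 a [c, d]), h0 a ha]
    simp only [askeyWilsonProd]
    ring_nf
  have hL : ∀ x ∈ [c, d], ‖x‖ < 1 := by simp [hc, hd]
  refine sub_eq_zero.mp (eq_zero_of_functional_equation hq0 hq
    (E := fun a b => betaIntegral q [a, b, c, d] - K * askeyWilsonProd q a b c d)
    ?_ ?_ ?_ ha hb hb0)
  · intro b hb
    exact (differentiableOn_betaIntegral hq (forall_mem_cons_norm_lt hb hL)).sub
      ((differentiableOn_askeyWilsonProd hq hb hc hd).const_mul K)
  · intro b hb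
    exact sub_eq_zero.mpr (h0 b hb)
  · intro a b ha hb
    linear_combination betaIntegral_contiguous hq ha hb hL -
      K * askeyWilsonProd_contiguous hq ha hb hc hd

theorem betaIntegral_four_eq_mul {q : ℝ} (hq0 : 0 < q) (hq1 : q < 1) {a b c d : ℂ}
    (ha : ‖a‖ < 1) (hb : ‖b‖ < 1) (hc : ‖c‖ < 1) (hd : ‖d‖ < 1) :
    betaIntegral q [a, b, c, d] = betaIntegral q [] * askeyWilsonProd q a b c d := by
  have hq : ‖(q : ℂ)‖ < 1 := by simpa [abs_of_pos hq0] using hq1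
  have hqc : (q : ℂ) ≠ 0 := by exact_mod_cast hq0.ne'
  have z : ‖(0 : ℂ)‖ < 1 := by simp
  have h2 : ∀ a b : ℂ, ‖a‖ < 1 → ‖b‖ < 1 →
      betaIntegral q [a, b, 0, 0] = betaIntegral q [] * askeyWilsonProd q a b 0 0 :=
    fun a b ha hb => betaIntegral_eq_askeyWilsonProd_of_zero hqc hq z z (fun b hb => by
      rw [betaIntegral_zero_cons, betaIntegral_perm q (L' := [0, 0, b])
        (List.perm_iff_count.mpr fun x => by simp [List.count_cons]; ring), betaIntegral_zero_cons,
        betaIntegral_zero_cons, betaIntegral_singleton hq0 hq1 hb]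
      simp [askeyWilsonProd]) ha hb
  have h3 : ∀ a b c : ℂ, ‖a‖ < 1 → ‖b‖ < 1 → ‖c‖ < 1 →
      betaIntegral q [a, b, c, 0] = betaIntegral q [] * askeyWilsonProd q a b c 0 :=
    fun a b c ha hb hc => betaIntegral_eq_askeyWilsonProd_of_zero hqc hq hc z (fun b hb => by
      rw [betaIntegral_perm q (L' := [b, c, 0, 0])
        (List.perm_iff_count.mpr fun x => by simp [List.count_cons]; ring), h2 b c hb hc]
      simp [askeyWilsonProd]) ha hb
  exact betaIntegral_eq_askeyWilsonProd_of_zero hqc hq hc hd (fun b hb => by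
      rw [betaIntegral_perm q (L' := [b, c, d, 0])
        (List.perm_iff_count.mpr fun x => by simp [List.count_cons]; ring), h3 b c d hb hc hd]
      simp [askeyWilsonProd]) ha hb

/-- The duplication formula `(x, -x, q^{1/2} x, -q^{1/2} x; q)_∞ = (x²; q)_∞`. -/
theorem qFacInf_mul_four {q p : ℂ} (hq : ‖q‖ < 1) (hp : p ^ 2 = q) (x : ℂ) :
    qFacInf q x * qFacInf q (-x) * qFacInf q (p * x) * qFacInf q (-(p * x)) =
      qFacInf q (x ^ 2) := by
  have ht : ∀ a, Tendsto (fun n => qFac q a n) atTop (𝓝 (qFacInf q a)) := fun a =>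
    (multipliable_qFacInf hq a).hasProd.tendsto_prod_nat
  have h2 : Tendsto (fun n : ℕ => 2 * n) atTop atTop :=
    tendsto_id.const_mul_atTop' (by norm_num)
  refine tendsto_nhds_unique ((((ht x).mul (ht (-x))).mul (ht (p * x))).mul (ht (-(p * x))))
    (((ht (x ^ 2)).comp h2).congr fun n => ?_)
  simp only [Function.comp_apply]
  induction n with
  | zero => simp
  | succ n ih =>
    rw [show 2 * (n + 1) = 2 * n + 1 + 1 by ring, qFac_succ, qFac_succ, ih]
    simp only [qFac_succ]
    have e1 : q ^ (2 * n + 1) = (p * q ^ n) ^ 2 := by rw [mul_pow, hp]; ring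
    have e2 : q ^ (2 * n) = (q ^ n) ^ 2 := by ring
    rw [e1, e2]
    ring

/-- The total mass of the weight. It is found by evaluating the Askey–Wilson integral at
`(q^{1/2}, -q^{1/2}, q, -q)`, where the integrand is `2 - 2 cos 2θ`. -/
theorem betaIntegral_nil {q : ℝ} (hq0 : 0 < q) (hq1 : q < 1) :
    betaIntegral q [] = 2 * Real.pi / qFacInf q q := by
  have hq : ‖(q : ℂ)‖ < 1 := by simpa [abs_of_pos hq0] using hq1
  obtain ⟨p, hp, hpn⟩ : ∃ p : ℂ, p ^ 2 = q ∧ ‖p‖ < 1 := by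
    refine ⟨Real.sqrt q, by exact_mod_cast Real.sq_sqrt hq0.le, ?_⟩
    rw [Complex.norm_real, Real.norm_of_nonneg (Real.sqrt_nonneg _)]
    exact (Real.sqrt_lt' one_pos).mpr (by simpa using hq1)
  have hqn : ‖-(q : ℂ)‖ < 1 := by rwa [norm_neg]
  have hpn' : ‖-p‖ < 1 := by rwa [norm_neg]
  have haw := betaIntegral_four_eq_mul hq0 hq1 hpn hpn' hq hqn
  have hint : betaIntegral q [p, -p, q, -q] = 2 * Real.pi := by
    have h : ∀ θ, betaIntegrand q [p, -p, q, -q] θ = ((2 - 2 * Real.cos (2 * θ) : ℝ) : ℂ) := by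
      intro θ
      have h0 := hFuns_cos_ne_zero hq (L := [p, -p, q, -q]) (by simp [hpn, hq1, abs_of_pos hq0]) θ
      rw [betaIntegrand, div_eq_iff h0]
      simp only [hFuns_cons, hFuns_nil, mul_one, hFun_cos_eq_mul hq, one_mul]
      have e2 : ∀ e : ℂ, qFacInf q (p * e) * qFacInf q (-p * e) * qFacInf q (q * e) *
          qFacInf q (-q * e) = qFacInf q (e ^ 2 * q) := by
        intro e
        have := qFacInf_mul_four hq hp (p * e)
        rw [mul_pow, hp, show p * (p * e) = q * e by rw [← hp]; ring] at this
        rw [neg_mul, neg_mul, this, mul_comm]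
      have e3 : Complex.exp ((2 * θ : ℝ) * Complex.I) = Complex.exp (θ * Complex.I) ^ 2 := by
        rw [← Complex.exp_nat_mul]; push_cast; ring_nf
      have e4 : Complex.exp (-((2 * θ : ℝ) * Complex.I)) = Complex.exp (-(θ * Complex.I)) ^ 2 := by
        rw [← Complex.exp_nat_mul]; push_cast; ring_nf
      have e5 : ((2 - 2 * Real.cos (2 * θ) : ℝ) : ℂ) =
          (1 - Complex.exp (θ * Complex.I) ^ 2) * (1 - Complex.exp (-(θ * Complex.I)) ^ 2) := by
        have h1 : Complex.exp (θ * Complex.I) * Complex.exp (-(θ * Complex.I)) = 1 := by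
          rw [← Complex.exp_add]; simp
        rw [← e3, ← e4]
        push_cast
        rw [Complex.cos, neg_mul]
        have h2 : Complex.exp (2 * θ * Complex.I) * Complex.exp (-(2 * θ * Complex.I)) = 1 := by
          rw [← Complex.exp_add]; simp
        linear_combination -h2
      rw [e3, e4, e5, qFacInf_eq_one_sub_mul hq (Complex.exp (θ * Complex.I) ^ 2),
        qFacInf_eq_one_sub_mul hq (Complex.exp (-(θ * Complex.I)) ^ 2), ← e2, ← e2]
      ring
    unfold betaIntegral
    simp only [h]
    rw [intervalIntegral.integral_ofReal, intervalIntegral.integral_sub (by simp)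
      (Continuous.intervalIntegrable (by fun_prop) _ _), intervalIntegral.integral_const_mul,
      intervalIntegral.integral_comp_mul_left (fun x => Real.cos x) two_ne_zero]
    have h0 : Real.sin (2 * Real.pi) = 0 := Real.sin_two_pi
    simp only [integral_cos, h0, mul_zero, Real.sin_zero, sub_self, sub_zero,
      intervalIntegral.integral_const, smul_eq_mul]
    push_cast
    ring
  rw [hint, askeyWilsonProd] at haw
  -- the remaining products are evaluated by `(-q, q^{3/2}, -q^{3/2}; q)_∞ = 1 / (1 - q)`
  have hqq : ‖(q : ℂ) * q‖ < 1 := norm_mul_lt_one hq hq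
  have f1 := qFacInf_mul_four hq hp q
  rw [pow_two, qFacInf_mul hq hq] at f1
  have f2 : qFacInf q (p * -p * q * -q) = qFacInf q q / (1 - q) / (1 - q * q) := by
    rw [show p * -p * (q : ℂ) * -q = q * q * q by rw [← hp]; ring, qFacInf_mul hq hqq,
      qFacInf_mul hq hq]
  have f3 : qFacInf q (q * -q) = qFacInf q (-q) / (1 + q) := by
    rw [show (q : ℂ) * -q = -q * q by ring, qFacInf_mul hq hqn, sub_neg_eq_add]
  have f4 : p * -p = -(q : ℂ) := by rw [← hp]; ring
  rw [f2, f3, f4, show p * -(q : ℂ) = -(p * q) by ring, show -p * (q : ℂ) = -(p * q) by ring,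
    show -p * -(q : ℂ) = p * q by ring] at haw
  have hpq := norm_mul_lt_one hpn hq
  have z1 := qFacInf_ne_zero hq hq
  have z2 := qFacInf_ne_zero hq hqn
  have z3 := qFacInf_ne_zero hq hpq
  have z4 := qFacInf_ne_zero hq (a := -(p * q)) (by rwa [norm_neg])
  have y1 := one_sub_ne_zero hq
  have y2 := one_sub_ne_zero hqn
  have y3 := one_sub_ne_zero hqq
  rw [sub_neg_eq_add] at y2
  have f5 : qFacInf q (-q) * qFacInf q (p * q) * qFacInf q (-(p * q)) = 1 / (1 - q) := by
    refine mul_left_cancel₀ z1 ?_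
    rw [← mul_assoc, ← mul_assoc, f1]
    ring
  have f6 : (qFacInf q q / (1 - q) / (1 - q * q)) / (qFacInf q (-q) * qFacInf q (p * q) *
      qFacInf q (-(p * q)) * qFacInf q (-(p * q)) * qFacInf q (p * q) *
      (qFacInf q (-q) / (1 + q))) = qFacInf q q := by
    have : qFacInf q (-q) * qFacInf q (p * q) *
      qFacInf q (-(p * q)) * qFacInf q (-(p * q)) * qFacInf q (p * q) *
      (qFacInf q (-q) / (1 + q)) = (qFacInf q (-q) * qFacInf q (p * q) *
      qFacInf q (-(p * q))) ^ 2 / (1 + q) := by ring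
    rw [this, f5, show 1 - (q : ℂ) * q = (1 - q) * (1 + q) by ring]
    field_simp
  rw [f6] at haw
  rw [haw]
  field_simp

/-! ### The very-well-poised series -/

theorem qFac_mul_left {q x : ℂ} (hx : ‖x‖ < 1) (n : ℕ) :
    qFac q (x * q) n = qFac q x n * ((1 - x * q ^ n) / (1 - x)) := by
  rw [← mul_div_assoc, ← qFac_succ, qFac_succ', mul_div_cancel_left₀ _ (one_sub_ne_zero hx)]

/-- The part of the `n`-th term of the very-well-poised series that remains when the factor
depending on `α` only is removed. -/
noncomputable def wpCore (q a b c d r : ℂ) (n : ℕ) : ℂ :=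
  qFacs q [a * b, a * c, a * d, a * r] n /
      qFacs q [q, a * b * c * d, a * b * c * r, a * b * d * r, a * c * d * r] n *
    (-(b * c * d * r)) ^ n * q ^ (n * (n - 1) / 2)

/-- The `n`-th term of the very-well-poised series with `α = a² b c d r / q`. -/
noncomputable def wpTerm (q a b c d r : ℂ) (n : ℕ) : ℂ :=
  vwpFactor q (a ^ 2 * b * c * d * r / q) n * wpCore q a b c d r n

theorem wpCore_eq (q a b c d r : ℂ) (n : ℕ) :
    wpCore q a b c d r n =
      qFac q (a * b) n * qFac q (a * c) n * qFac q (a * d) n * qFac q (a * r) n /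
        (qFac q q n * qFac q (a * b * c * d) n * qFac q (a * b * c * r) n *
          qFac q (a * b * d * r) n * qFac q (a * c * d * r) n) *
      (-(b * c * d * r)) ^ n * q ^ (n * (n - 1) / 2) := by
  simp [wpCore, qFacs, mul_assoc]

theorem wpCore_swap (q a b c d r : ℂ) (n : ℕ) : wpCore q a c b d r n = wpCore q a b c d r n := by
  rw [wpCore_eq, wpCore_eq, show a * c * b * d = a * b * c * d by ring,
    show a * c * b * r = a * b * c * r by ring, show c * b * d * r = b * c * d * r by ring]
  ring

theorem wpTerm_swap (q a b c d r : ℂ) (n : ℕ) : wpTerm q a c b d r n = wpTerm q a b c d r n := by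
  rw [wpTerm, wpTerm, wpCore_swap]
  ring_nf

theorem wpTerm_zero (q a b c d r : ℂ) : wpTerm q a b c d r 0 = 1 := by
  simp [wpTerm, wpCore_eq, vwpFactor_eq]

theorem vwpFactor_div_succ {q : ℂ} (hq0 : q ≠ 0) (e : ℂ) (n : ℕ) :
    vwpFactor q (e / q) (n + 1) = (1 - e * q ^ (2 * n + 1)) * qFac q e n := by
  rw [vwpFactor_eq, if_neg n.succ_ne_zero, div_mul_cancel₀ _ hq0, Nat.add_sub_cancel]
  congr 2
  field_simp
  ring

theorem one_sub_mul_vwpFactor {q e : ℂ} (he : ‖e‖ < 1) (n : ℕ) :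
    (1 - e) * vwpFactor q e n = (1 - e * q ^ (2 * n)) * qFac q e n := by
  have h := one_sub_ne_zero he
  rw [vwpFactor, if_neg (fun h' => h (by rw [h', sub_self])), mul_div_cancel₀ _ h]

/-- Bounds for the terms that are uniform in the parameters. -/
theorem exists_norm_wp_le {q : ℂ} (hq0 : q ≠ 0) (hq : ‖q‖ < 1) {ρ : ℝ} (hρ : ρ < 1) :
    ∃ M : ℝ, 0 < M ∧ ∀ a b c d r : ℂ, ‖a‖ ≤ ρ → ‖b‖ < 1 → ‖c‖ < 1 → ‖d‖ < 1 → ‖r‖ < 1 →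
      ∀ n, ‖wpTerm q a b c d r n‖ ≤ M * ‖b * c * d * r‖ ^ n ∧
        ‖qFac q (a ^ 2 * b * c * d * r) n * wpCore q a b c d r n‖ ≤ M * ‖b * c * d * r‖ ^ n := by
  obtain ⟨M, hM, h1⟩ := exists_norm_qFac_le hq 1
  obtain ⟨N, hN, h2⟩ := exists_norm_inv_qFac_le hq hρ
  obtain ⟨N', hN', h2'⟩ := exists_norm_inv_qFac_le hq hq
  refine ⟨(2 * M + 1) * (M ^ 4 * N' * N ^ 4), by positivity,
    fun a b c d r ha hb hc hd hr n => ?_⟩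
  have ha1 : ‖a‖ < 1 := ha.trans_lt hρ
  have hA : ∀ x : ℂ, ‖x‖ < 1 → ∀ n, ‖qFac q (a * x) n‖ ≤ M := fun x hx n =>
    h1 _ (norm_mul_lt_one ha1 hx).le n
  have hB : ∀ x y z : ℂ, ‖x‖ < 1 → ‖y‖ < 1 → ‖z‖ < 1 → ‖(qFac q (a * x * y * z) n)⁻¹‖ ≤ N := by
    intro x y z hx hy hz
    refine h2 _ ?_ n
    have := (norm_mul_lt_one (norm_mul_lt_one hx hy) hz).le
    calc ‖a * x * y * z‖ = ‖a‖ * ‖x * y * z‖ := by rw [← norm_mul]; ring_nf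
      _ ≤ ‖a‖ * 1 := by gcongr
      _ ≤ ρ := by simpa using ha
  have hqn : ‖q ^ (n * (n - 1) / 2)‖ ≤ 1 := by
    rw [norm_pow]; exact pow_le_one₀ (norm_nonneg _) hq.le
  have hcore : ‖wpCore q a b c d r n‖ ≤ (M ^ 4 * N' * N ^ 4) * ‖b * c * d * r‖ ^ n := by
    rw [wpCore_eq, div_eq_mul_inv, mul_inv, mul_inv, mul_inv, mul_inv]
    simp only [norm_mul _ (q ^ (n * (n - 1) / 2)), norm_mul _ ((-(b * c * d * r)) ^ n), norm_pow,
      norm_neg]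
    calc _ ≤ ‖qFac q (a * b) n * qFac q (a * c) n * qFac q (a * d) n * qFac q (a * r) n *
        ((qFac q q n)⁻¹ * (qFac q (a * b * c * d) n)⁻¹ * (qFac q (a * b * c * r) n)⁻¹ *
          (qFac q (a * b * d * r) n)⁻¹ * (qFac q (a * c * d * r) n)⁻¹)‖ *
          ‖b * c * d * r‖ ^ n * 1 := by
          gcongr
          rwa [← norm_pow]
      _ ≤ (M * M * M * M * (N' * N * N * N * N)) * ‖b * c * d * r‖ ^ n * 1 := by
          gcongr
          simp only [norm_mul]
          have i1 := hA b hb n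
          have i2 := hA c hc n
          have i3 := hA d hd n
          have i4 := hA r hr n
          have i5 := hB b c d hb hc hd
          have i6 := hB b c r hb hc hr
          have i7 := hB b d r hb hd hr
          have i8 := hB c d r hc hd hr
          have i9 := h2' q le_rfl n
          gcongr
      _ = _ := by ring
  have he : ‖a ^ 2 * b * c * d * r‖ < 1 := by
    rw [pow_two]
    exact norm_mul_lt_one (norm_mul_lt_one (norm_mul_lt_one (norm_mul_lt_one
      (norm_mul_lt_one ha1 ha1) hb) hc) hd) hr
  have hv : ‖vwpFactor q (a ^ 2 * b * c * d * r / q) n‖ ≤ 2 * M + 1 := by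
    cases n with
    | zero =>
      simp only [vwpFactor_eq, if_true, norm_one]
      linarith
    | succ n =>
      rw [vwpFactor_div_succ hq0, norm_mul]
      have i1 : ‖1 - a ^ 2 * b * c * d * r * q ^ (2 * n + 1)‖ ≤ 2 := by
        refine (norm_sub_le _ _).trans ?_
        have := (norm_mul_pow_lt_one hq he (2 * n + 1)).le
        rw [norm_one]
        linarith
      have i2 := h1 _ he.le n
      have : ‖1 - a ^ 2 * b * c * d * r * q ^ (2 * n + 1)‖ *
          ‖qFac q (a ^ 2 * b * c * d * r) n‖ ≤ 2 * M := by gcongr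
      linarith
  constructor
  · rw [wpTerm, norm_mul, mul_assoc (2 * M + 1)]
    exact mul_le_mul hv hcore (norm_nonneg _) (by positivity)
  · rw [norm_mul, mul_assoc (2 * M + 1)]
    exact mul_le_mul ((h1 _ he.le n).trans (by linarith)) hcore (norm_nonneg _) (by positivity)

theorem wpCore_succ {q a b c d r : ℂ} (n : ℕ) :
    wpCore q a b c d r (n + 1) = wpCore q a b c d r n *
      ((1 - a * b * q ^ n) * (1 - a * c * q ^ n) * (1 - a * d * q ^ n) * (1 - a * r * q ^ n) /
        ((1 - q ^ (n + 1)) * (1 - a * b * c * d * q ^ n) * (1 - a * b * c * r * q ^ n) *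
          (1 - a * b * d * r * q ^ n) * (1 - a * c * d * r * q ^ n)) *
        (-(b * c * d * r) * q ^ n)) := by
  have hn : (n + 1) * (n + 1 - 1) / 2 = n * (n - 1) / 2 + n := by
    rw [Nat.triangle_succ]
  rw [wpCore_eq, wpCore_eq, hn, pow_add, pow_succ (-(b * c * d * r))]
  simp only [qFac_succ]
  rw [show q * q ^ n = q ^ (n + 1) by ring]
  simp only [div_eq_mul_inv, mul_inv]
  ring

/-- With `u n = q ^ n (qα; q)_n * wpCore n`, the difference of the `(n + 1)`-st term of the series
and `u (n + 1)` is a rational multiple of `u n`, because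
`(1 - e q ^ (2 n + 1)) - q ^ (n + 1) (1 - e q ^ n) = 1 - q ^ (n + 1)`. -/
theorem wpTerm_succ_sub {q a b c d r : ℂ} (hq0 : q ≠ 0) (hq : ‖q‖ < 1) (n : ℕ) :
    wpTerm q a b c d r (n + 1) - q ^ (n + 1) *
      (qFac q (a ^ 2 * b * c * d * r) (n + 1) * wpCore q a b c d r (n + 1)) =
    qFac q (a ^ 2 * b * c * d * r) n * wpCore q a b c d r n *
      ((1 - a * b * q ^ n) * (1 - a * c * q ^ n) * (1 - a * d * q ^ n) * (1 - a * r * q ^ n) /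
        ((1 - a * b * c * d * q ^ n) * (1 - a * b * c * r * q ^ n) *
          (1 - a * b * d * r * q ^ n) * (1 - a * c * d * r * q ^ n)) *
        (-(b * c * d * r) * q ^ n)) := by
  have h : (1 : ℂ) - q ^ (n + 1) ≠ 0 := one_sub_ne_zero (by
    rw [norm_pow]; exact pow_lt_one₀ (norm_nonneg _) hq (by simp))
  rw [wpTerm, vwpFactor_div_succ hq0, qFac_succ, wpCore_succ]
  set P := (1 - a * b * q ^ n) * (1 - a * c * q ^ n) * (1 - a * d * q ^ n) * (1 - a * r * q ^ n)
  have hP : ∀ A B C D : ℂ, P / ((1 - q ^ (n + 1)) * A * B * C * D) =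
      P / (A * B * C * D) / (1 - q ^ (n + 1)) := by
    intro A B C D
    rw [div_div]
    ring_nf
  rw [hP]
  generalize P / _ = R
  field_simp
  ring

theorem wpCore_mul_left {q a b c d r : ℂ} (ha : ‖a‖ < 1) (hb : ‖b‖ < 1) (hc : ‖c‖ < 1)
    (hd : ‖d‖ < 1) (hr : ‖r‖ < 1) (n : ℕ) :
    wpCore q a (b * q) c d r n = wpCore q a b c d r n * q ^ n *
      ((1 - a * b * q ^ n) / (1 - a * b) *
        ((1 - a * b * c * d) * (1 - a * b * c * r) * (1 - a * b * d * r)) /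
        ((1 - a * b * c * d * q ^ n) * (1 - a * b * c * r * q ^ n) *
          (1 - a * b * d * r * q ^ n))) := by
  have hab := norm_mul_lt_one ha hb
  have h1 := norm_mul_lt_one (norm_mul_lt_one hab hc) hd
  have h2 := norm_mul_lt_one (norm_mul_lt_one hab hc) hr
  have h3 := norm_mul_lt_one (norm_mul_lt_one hab hd) hr
  rw [wpCore_eq, wpCore_eq, show a * (b * q) = a * b * q by ring,
    show a * b * q * c * d = a * b * c * d * q by ring,
    show a * b * q * c * r = a * b * c * r * q by ring,
    show a * b * q * d * r = a * b * d * r * q by ring,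
    show -(b * q * c * d * r) = -(b * c * d * r) * q by ring, mul_pow,
    qFac_mul_left hab, qFac_mul_left h1, qFac_mul_left h2, qFac_mul_left h3]
  simp only [div_eq_mul_inv, mul_inv, inv_inv]
  ring

/-- The terms of the series with `b q` for `b`, with the factor that comes from the product. -/
theorem mul_wpTerm_mul_left {q a b c d r : ℂ} (hq0 : q ≠ 0) (ha : ‖a‖ < 1)
    (hb : ‖b‖ < 1) (hc : ‖c‖ < 1) (hd : ‖d‖ < 1) (hr : ‖r‖ < 1) (n : ℕ) :
    (1 - a * b) * (1 - b * d) * (1 - b * r) * (1 - a ^ 2 * b * c * d * r) /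
        ((1 - a * b * c * d) * (1 - a * b * c * r) * (1 - a * b * d * r)) *
        wpTerm q a (b * q) c d r n =
      qFac q (a ^ 2 * b * c * d * r) n * wpCore q a b c d r n * q ^ n *
        ((1 - b * d) * (1 - b * r) * (1 - a ^ 2 * b * c * d * r * (q ^ n) ^ 2) *
          (1 - a * b * q ^ n) /
        ((1 - a * b * c * d * q ^ n) * (1 - a * b * c * r * q ^ n) *
          (1 - a * b * d * r * q ^ n))) := by
  have hab := norm_mul_lt_one ha hb
  have h1 := one_sub_ne_zero (norm_mul_lt_one (norm_mul_lt_one hab hc) hd)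
  have h2 := one_sub_ne_zero (norm_mul_lt_one (norm_mul_lt_one hab hc) hr)
  have h3 := one_sub_ne_zero (norm_mul_lt_one (norm_mul_lt_one hab hd) hr)
  have h4 := one_sub_ne_zero hab
  have he : ‖a ^ 2 * b * c * d * r‖ < 1 := by
    rw [pow_two]
    exact norm_mul_lt_one (norm_mul_lt_one (norm_mul_lt_one (norm_mul_lt_one
      (norm_mul_lt_one ha ha) hb) hc) hd) hr
  have hv := one_sub_mul_vwpFactor (q := q) he n
  rw [wpTerm, wpCore_mul_left ha hb hc hd hr,
    show a ^ 2 * (b * q) * c * d * r / q = a ^ 2 * b * c * d * r by field_simp]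
  rw [show q ^ (2 * n) = (q ^ n) ^ 2 by ring] at hv
  generalize vwpFactor q (a ^ 2 * b * c * d * r) n = v at *
  generalize qFac q (a ^ 2 * b * c * d * r) n = u at *
  generalize a ^ 2 * b * c * d * r = e at *
  generalize q ^ n = x at *
  generalize wpCore q a b c d r n = w
  generalize 1 - a * b = A at *
  generalize 1 - a * b * c * d = B at *
  generalize 1 - a * b * c * r = C at *
  generalize 1 - a * b * d * r = D at *
  generalize (1 - a * b * c * d * x) * (1 - a * b * c * r * x) * (1 - a * b * d * r * x) = E
  have : A * (1 - b * d) * (1 - b * r) * (1 - e) / (B * C * D) *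
      (v * (w * x * ((1 - a * b * x) / A * (B * C * D) / E))) =
      ((1 - e) * v) * (w * x * ((1 - b * d) * (1 - b * r) * (1 - a * b * x) / E)) := by
    field_simp
  rw [this, hv]
  ring

theorem wp_polynomial_identity (a b c d r x : ℂ) :
    c * ((1 - b * d) * (1 - b * r) * (1 - a ^ 2 * b * c * d * r * x ^ 2) * (1 - a * b * x)) *
        (1 - a * c * d * r * x) -
      b * ((1 - c * d) * (1 - c * r) * (1 - a ^ 2 * b * c * d * r * x ^ 2) * (1 - a * c * x)) *
        (1 - a * b * d * r * x) =
    (c - b) * ((1 - a * b * c * d * x) * (1 - a * b * c * r * x) * (1 - a * b * d * r * x) *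
        (1 - a * c * d * r * x) -
      b * c * d * r * ((1 - a * b * x) * (1 - a * c * x) * (1 - a * d * x) * (1 - a * r * x))) := by
  ring

theorem summable_wpTerm {q a b c d r : ℂ} (hq0 : q ≠ 0) (hq : ‖q‖ < 1) (ha : ‖a‖ < 1)
    (hb : ‖b‖ < 1) (hc : ‖c‖ < 1) (hd : ‖d‖ < 1) (hr : ‖r‖ < 1) :
    Summable (wpTerm q a b c d r) := by
  obtain ⟨M, -, hM⟩ := exists_norm_wp_le hq0 hq ha
  have h := norm_mul_lt_one (norm_mul_lt_one (norm_mul_lt_one hb hc) hd) hr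
  exact .of_norm_bounded ((summable_geometric_of_lt_one (norm_nonneg _) h).mul_left M)
    fun n => (hM a b c d r le_rfl hb hc hd hr n).1

theorem tsum_wpTerm_contiguous {q a b c d r : ℂ} (hq0 : q ≠ 0) (hq : ‖q‖ < 1) (ha : ‖a‖ < 1)
    (hb : ‖b‖ < 1) (hc : ‖c‖ < 1) (hd : ‖d‖ < 1) (hr : ‖r‖ < 1) :
    c * ((1 - a * b) * (1 - b * d) * (1 - b * r) * (1 - a ^ 2 * b * c * d * r) /
        ((1 - a * b * c * d) * (1 - a * b * c * r) * (1 - a * b * d * r)) *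
        ∑' n, wpTerm q a (b * q) c d r n) -
      b * ((1 - a * c) * (1 - c * d) * (1 - c * r) * (1 - a ^ 2 * b * c * d * r) /
        ((1 - a * b * c * d) * (1 - a * b * c * r) * (1 - a * c * d * r)) *
        ∑' n, wpTerm q a b (c * q) d r n) =
    (c - b) * ∑' n, wpTerm q a b c d r n := by
  obtain ⟨M, -, hM⟩ := exists_norm_wp_le hq0 hq ha
  have hbcdr := norm_mul_lt_one (norm_mul_lt_one (norm_mul_lt_one hb hc) hd) hr
  have hT := summable_wpTerm hq0 hq ha hb hc hd hr
  have hT1 := summable_wpTerm hq0 hq ha (norm_mul_lt_one hb hq) hc hd hr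
  have hT2 := summable_wpTerm hq0 hq ha hb (norm_mul_lt_one hc hq) hd hr
  set u : ℕ → ℂ := fun n => q ^ n * (qFac q (a ^ 2 * b * c * d * r) n * wpCore q a b c d r n)
    with hu
  have hus : Summable u := by
    refine .of_norm_bounded ((summable_geometric_of_lt_one (norm_nonneg _) hbcdr).mul_left M)
      fun n => ?_
    rw [hu, norm_mul, norm_pow]
    exact (mul_le_of_le_one_left (norm_nonneg _) (pow_le_one₀ (norm_nonneg _) hq.le)).trans
      (hM a b c d r le_rfl hb hc hd hr n).2
  -- With `t` the terms of the series, `t (n + 1) - u (n + 1)` is a multiple of `u n`; the series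
  -- is summed as `∑ (u n + (t (n + 1) - u (n + 1)))`.
  have hS : ∑' n, wpTerm q a b c d r n =
      ∑' n, (u n + (wpTerm q a b c d r (n + 1) - u (n + 1))) := by
    have h1 := (summable_nat_add_iff 1).mpr hT
    have h2 := (summable_nat_add_iff 1).mpr hus
    rw [hus.tsum_add (h1.sub h2), h1.tsum_sub h2, hT.tsum_eq_zero_add, hus.tsum_eq_zero_add,
      wpTerm_zero]
    simp [hu, wpCore_eq]
  rw [hS, ← tsum_mul_left, ← tsum_mul_left, ← tsum_mul_left, ← tsum_mul_left, ← tsum_mul_left,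
    ← ((hT1.mul_left _).mul_left _).tsum_sub ((hT2.mul_left _).mul_left _)]
  refine tsum_congr fun n => ?_
  have e2 := mul_wpTerm_mul_left hq0 ha hc hb hd hr n
  rw [wpTerm_swap q a b (c * q), wpCore_swap, show a * c * b * d = a * b * c * d by ring,
    show a * c * b * r = a * b * c * r by ring,
    show a ^ 2 * c * b * d * r = a ^ 2 * b * c * d * r by ring] at e2
  rw [mul_wpTerm_mul_left hq0 ha hb hc hd hr n, e2]
  simp only [hu]
  rw [wpTerm_succ_sub hq0 hq]
  have hab := norm_mul_lt_one ha hb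
  have hac := norm_mul_lt_one ha hc
  have h1 := one_sub_ne_zero
    (norm_mul_pow_lt_one hq (norm_mul_lt_one (norm_mul_lt_one hab hc) hd) n)
  have h2 := one_sub_ne_zero
    (norm_mul_pow_lt_one hq (norm_mul_lt_one (norm_mul_lt_one hab hc) hr) n)
  have h3 := one_sub_ne_zero
    (norm_mul_pow_lt_one hq (norm_mul_lt_one (norm_mul_lt_one hab hd) hr) n)
  have h4 := one_sub_ne_zero
    (norm_mul_pow_lt_one hq (norm_mul_lt_one (norm_mul_lt_one hac hd) hr) n)
  have hp := wp_polynomial_identity a b c d r (q ^ n)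
  generalize wpCore q a b c d r n = w
  generalize qFac q (a ^ 2 * b * c * d * r) n = v
  generalize q ^ n = x at *
  generalize (1 - b * d) * (1 - b * r) * (1 - a ^ 2 * b * c * d * r * x ^ 2) * (1 - a * b * x) = P
    at *
  generalize (1 - c * d) * (1 - c * r) * (1 - a ^ 2 * b * c * d * r * x ^ 2) * (1 - a * c * x) = R
    at *
  generalize (1 - a * b * x) * (1 - a * c * x) * (1 - a * d * x) * (1 - a * r * x) = S at *
  generalize 1 - a * b * c * d * x = A at *
  generalize 1 - a * b * c * r * x = B at *
  generalize 1 - a * b * d * r * x = C at *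
  generalize 1 - a * c * d * r * x = D at *
  field_simp
  linear_combination v * w * x * hp

/-! ### The integral with five parameters -/

/-- The product `(abcd, abcr, abdr, acdr; q)_∞ / (ab, ac, ad, ar, bc, bd, br, cd, cr, dr, qα; q)_∞`
with `qα = a² b c d r`. -/
noncomputable def wpProd (q a b c d r : ℂ) : ℂ :=
  (qFacInf q (a * b * c * d) * qFacInf q (a * b * c * r) * qFacInf q (a * b * d * r) *
      qFacInf q (a * c * d * r)) /
    (qFacInf q (a * b) * qFacInf q (a * c) * qFacInf q (a * d) * qFacInf q (a * r) *
      qFacInf q (b * c) * qFacInf q (b * d) * qFacInf q (b * r) * qFacInf q (c * d) *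
      qFacInf q (c * r) * qFacInf q (d * r) * qFacInf q (a ^ 2 * b * c * d * r))

theorem norm_sq_mul_lt_one {a b c d r : ℂ} (ha : ‖a‖ < 1) (hb : ‖b‖ < 1) (hc : ‖c‖ < 1)
    (hd : ‖d‖ < 1) (hr : ‖r‖ < 1) : ‖a ^ 2 * b * c * d * r‖ < 1 := by
  rw [pow_two]
  exact norm_mul_lt_one (norm_mul_lt_one (norm_mul_lt_one (norm_mul_lt_one
    (norm_mul_lt_one ha ha) hb) hc) hd) hr

theorem wpProd_swap (q a b c d r : ℂ) : wpProd q a c b d r = wpProd q a b c d r := by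
  rw [wpProd, wpProd, show a * c * b * d = a * b * c * d by ring,
    show a * c * b * r = a * b * c * r by ring, mul_comm c b,
    show a ^ 2 * c * b * d * r = a ^ 2 * b * c * d * r by ring]
  ring

theorem wpProd_mul_left {q a b c d r : ℂ} (hq : ‖q‖ < 1) (ha : ‖a‖ < 1)
    (hb : ‖b‖ < 1) (hc : ‖c‖ < 1) (hd : ‖d‖ < 1) (hr : ‖r‖ < 1) :
    wpProd q a (b * q) c d r = wpProd q a b c d r * ((1 - b * c) *
      ((1 - a * b) * (1 - b * d) * (1 - b * r) * (1 - a ^ 2 * b * c * d * r) /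
        ((1 - a * b * c * d) * (1 - a * b * c * r) * (1 - a * b * d * r)))) := by
  have hab := norm_mul_lt_one ha hb
  rw [wpProd, wpProd, show a * (b * q) * c * d = a * b * c * d * q by ring,
    show a * (b * q) * c * r = a * b * c * r * q by ring,
    show a * (b * q) * d * r = a * b * d * r * q by ring, show a * (b * q) = a * b * q by ring,
    show b * q * c = b * c * q by ring, show b * q * d = b * d * q by ring,
    show b * q * r = b * r * q by ring,
    show a ^ 2 * (b * q) * c * d * r = a ^ 2 * b * c * d * r * q by ring,
    qFacInf_mul hq (norm_mul_lt_one (norm_mul_lt_one hab hc) hd),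
    qFacInf_mul hq (norm_mul_lt_one (norm_mul_lt_one hab hc) hr),
    qFacInf_mul hq (norm_mul_lt_one (norm_mul_lt_one hab hd) hr),
    qFacInf_mul hq hab, qFacInf_mul hq (norm_mul_lt_one hb hc),
    qFacInf_mul hq (norm_mul_lt_one hb hd), qFacInf_mul hq (norm_mul_lt_one hb hr),
    qFacInf_mul hq (norm_sq_mul_lt_one ha hb hc hd hr)]
  simp only [div_eq_mul_inv, mul_inv, inv_inv]
  ring

theorem wpProd_mul_tsum_contiguous {q a b c d r : ℂ} (hq0 : q ≠ 0) (hq : ‖q‖ < 1) (ha : ‖a‖ < 1)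
    (hb : ‖b‖ < 1) (hc : ‖c‖ < 1) (hd : ‖d‖ < 1) (hr : ‖r‖ < 1) :
    c * (wpProd q a (b * q) c d r * ∑' n, wpTerm q a (b * q) c d r n) -
        b * (wpProd q a b (c * q) d r * ∑' n, wpTerm q a b (c * q) d r n) =
      (c - b) * (1 - b * c) * (wpProd q a b c d r * ∑' n, wpTerm q a b c d r n) := by
  have h2 := wpProd_mul_left hq ha hc hb hd hr
  rw [wpProd_swap q a b (c * q), wpProd_swap q a b c, show a * c * b * d = a * b * c * d by ring,
    show a * c * b * r = a * b * c * r by ring, mul_comm c b,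
    show a ^ 2 * c * b * d * r = a ^ 2 * b * c * d * r by ring] at h2
  rw [wpProd_mul_left hq ha hb hc hd hr, h2]
  linear_combination wpProd q a b c d r * (1 - b * c) *
    tsum_wpTerm_contiguous hq0 hq ha hb hc hd hr

theorem differentiableOn_wpProd {q a c d r : ℂ} (hq : ‖q‖ < 1) (ha : ‖a‖ < 1)
    (hc : ‖c‖ < 1) (hd : ‖d‖ < 1) (hr : ‖r‖ < 1) :
    DifferentiableOn ℂ (fun b => wpProd q a b c d r) (Metric.ball 0 1) := by
  intro b hb
  have hb : ‖b‖ < 1 := by simpa using hb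
  have hm : ∀ u : ℂ → ℂ, Differentiable ℂ u → Differentiable ℂ fun z => qFacInf q (u z) :=
    fun u hu => (differentiable_qFacInf hq).comp hu
  refine DifferentiableAt.differentiableWithinAt (DifferentiableAt.div ?_ ?_ ?_)
  · have h1 := hm (fun b => a * b * c * d) (by fun_prop)
    have h2 := hm (fun b => a * b * c * r) (by fun_prop)
    have h3 := hm (fun b => a * b * d * r) (by fun_prop)
    fun_prop
  · have h1 := hm (fun b => a * b) (by fun_prop)
    have h2 := hm (fun b => b * c) (by fun_prop)
    have h3 := hm (fun b => b * d) (by fun_prop)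
    have h4 := hm (fun b => b * r) (by fun_prop)
    have h5 := hm (fun b => a ^ 2 * b * c * d * r) (by fun_prop)
    fun_prop
  · have z1 := qFacInf_ne_zero hq (norm_mul_lt_one ha hb)
    have z2 := qFacInf_ne_zero hq (norm_mul_lt_one ha hc)
    have z3 := qFacInf_ne_zero hq (norm_mul_lt_one ha hd)
    have z4 := qFacInf_ne_zero hq (norm_mul_lt_one ha hr)
    have z5 := qFacInf_ne_zero hq (norm_mul_lt_one hb hc)
    have z6 := qFacInf_ne_zero hq (norm_mul_lt_one hb hd)
    have z7 := qFacInf_ne_zero hq (norm_mul_lt_one hb hr)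
    have z8 := qFacInf_ne_zero hq (norm_mul_lt_one hc hd)
    have z9 := qFacInf_ne_zero hq (norm_mul_lt_one hc hr)
    have z10 := qFacInf_ne_zero hq (norm_mul_lt_one hd hr)
    have z11 := qFacInf_ne_zero hq (norm_sq_mul_lt_one ha hb hc hd hr)
    positivity

theorem differentiableOn_wpTerm {q a c d r : ℂ} (hq0 : q ≠ 0) (hq : ‖q‖ < 1) (ha : ‖a‖ < 1)
    (hc : ‖c‖ < 1) (hd : ‖d‖ < 1) (hr : ‖r‖ < 1) (n : ℕ) :
    DifferentiableOn ℂ (fun b => wpTerm q a b c d r n) (Metric.ball 0 1) := by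
  have hm : ∀ (u : ℂ → ℂ) (m : ℕ), Differentiable ℂ u →
      Differentiable ℂ fun z => qFac q (u z) m := fun u m hu => (differentiable_qFac q m).comp hu
  cases n with
  | zero =>
    simp only [wpTerm_zero]
    exact differentiableOn_const _
  | succ n =>
    intro b hb
    have hb : ‖b‖ < 1 := by simpa using hb
    have hab := norm_mul_lt_one ha hb
    simp only [wpTerm, vwpFactor_div_succ hq0, wpCore_eq]
    have h1 := hm (fun b => a ^ 2 * b * c * d * r) n (by fun_prop)
    have h2 := hm (fun b => a * b) (n + 1) (by fun_prop)
    have h3 := hm (fun b => a * b * c * d) (n + 1) (by fun_prop)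
    have h4 := hm (fun b => a * b * c * r) (n + 1) (by fun_prop)
    have h5 := hm (fun b => a * b * d * r) (n + 1) (by fun_prop)
    have z1 := qFac_ne_zero hq hq (n + 1)
    have z2 := qFac_ne_zero hq (norm_mul_lt_one (norm_mul_lt_one hab hc) hd) (n + 1)
    have z3 := qFac_ne_zero hq (norm_mul_lt_one (norm_mul_lt_one hab hc) hr) (n + 1)
    have z4 := qFac_ne_zero hq (norm_mul_lt_one (norm_mul_lt_one hab hd) hr) (n + 1)
    have z5 := qFac_ne_zero hq
      (norm_mul_lt_one (norm_mul_lt_one (norm_mul_lt_one ha hc) hd) hr) (n + 1)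
    refine DifferentiableAt.differentiableWithinAt (DifferentiableAt.mul (by fun_prop)
      ((DifferentiableAt.mul (DifferentiableAt.div (by fun_prop) (by fun_prop) ?_)
        (by fun_prop)).mul (by fun_prop)))
    positivity

theorem differentiableOn_tsum_wpTerm {q a c d r : ℂ} (hq0 : q ≠ 0) (hq : ‖q‖ < 1) (ha : ‖a‖ < 1)
    (hc : ‖c‖ < 1) (hd : ‖d‖ < 1) (hr : ‖r‖ < 1) :
    DifferentiableOn ℂ (fun b => ∑' n, wpTerm q a b c d r n) (Metric.ball 0 1) := by
  obtain ⟨M, hM0, hM⟩ := exists_norm_wp_le hq0 hq ha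
  have h := norm_mul_lt_one (norm_mul_lt_one hc hd) hr
  refine Complex.differentiableOn_tsum_of_summable_norm
    (u := fun n => M * ‖c * d * r‖ ^ n)
    ((summable_geometric_of_lt_one (norm_nonneg _) h).mul_left M)
    (differentiableOn_wpTerm hq0 hq ha hc hd hr) Metric.isOpen_ball fun n b hb => ?_
  have hb : ‖b‖ < 1 := by simpa using hb
  refine ((hM a b c d r le_rfl hb hc hd hr n).1).trans ?_
  gcongr
  rw [mul_assoc, mul_assoc, ← mul_assoc c, norm_mul]
  exact mul_le_of_le_one_left (norm_nonneg _) hb.le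

theorem wpProd_zero_mul_tsum (q a c d r : ℂ) :
    wpProd q a 0 c d r * ∑' n, wpTerm q a 0 c d r n = askeyWilsonProd q a c d r := by
  have h : ∀ n ≠ 0, wpTerm q a 0 c d r n = 0 := fun n hn => by simp [wpTerm, wpCore, hn]
  rw [tsum_eq_single 0 h, wpTerm_zero, mul_one]
  simp [wpProd, askeyWilsonProd]

/-- The `q`-beta integral with five parameters as a very-well-poised series. Both sides satisfy the
contiguity relation in `b` and `c`, and they agree for `b = 0` by the Askey–Wilson integral. -/
theorem betaIntegral_five {q : ℝ} (hq0 : 0 < q) (hq1 : q < 1) {a b c d r : ℂ}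
    (ha : ‖a‖ < 1) (hb : ‖b‖ < 1) (hc : ‖c‖ < 1) (hd : ‖d‖ < 1) (hr : ‖r‖ < 1) :
    betaIntegral q [a, b, c, d, r] =
      2 * Real.pi / qFacInf q q * (wpProd q a b c d r * ∑' n, wpTerm q a b c d r n) := by
  have hq : ‖(q : ℂ)‖ < 1 := by simpa [abs_of_pos hq0] using hq1
  have hqc : (q : ℂ) ≠ 0 := by exact_mod_cast hq0.ne'
  have hzero : ∀ c : ℂ, ‖c‖ < 1 → betaIntegral q [0, c, a, d, r] =
      2 * Real.pi / qFacInf q q * (wpProd q a 0 c d r * ∑' n, wpTerm q a 0 c d r n) := by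
    intro c hc
    rw [betaIntegral_zero_cons, betaIntegral_perm q (List.Perm.swap a c [d, r]),
      betaIntegral_four_eq_mul hq0 hq1 ha hc hd hr, wpProd_zero_mul_tsum, betaIntegral_nil hq0 hq1]
  have hperm : betaIntegral q [a, b, c, d, r] = betaIntegral q [b, c, a, d, r] :=
    betaIntegral_perm q ((List.Perm.swap b a _).trans (List.Perm.cons b (List.Perm.swap c a _)))
  rw [hperm]
  rcases eq_or_ne c 0 with rfl | hc0
  · rw [betaIntegral_perm q (List.Perm.swap 0 b _), hzero b hb, wpProd_swap]
    simp only [wpTerm_swap q a b 0]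
  have hL : ∀ x ∈ [a, d, r], ‖x‖ < 1 := by simp [ha, hd, hr]
  refine sub_eq_zero.mp (eq_zero_of_functional_equation hqc hq
    (E := fun b c => betaIntegral q [b, c, a, d, r] -
      2 * Real.pi / qFacInf q q * (wpProd q a b c d r * ∑' n, wpTerm q a b c d r n))
    ?_ ?_ ?_ hb hc hc0)
  · intro c hc
    exact (differentiableOn_betaIntegral hq (forall_mem_cons_norm_lt hc hL)).sub
      (((differentiableOn_wpProd hq ha hc hd hr).mul
        (differentiableOn_tsum_wpTerm hqc hq ha hc hd hr)).const_mul _)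
  · intro c hc
    exact sub_eq_zero.mpr (hzero c hc)
  · intro b c hb hc
    linear_combination betaIntegral_contiguous hq hb hc hL -
      2 * Real.pi / qFacInf q q * wpProd_mul_tsum_contiguous hqc hq ha hb hc hd hr

/-! ### Shifting the first parameter -/

/-- The reversal `(q^{-n}; q)_k = (-1)^k q^{k(k-1)/2 - nk} (q; q)_n / (q; q)_{n-k}`, where
`n = m + k`, cleared of denominators. -/
theorem qFac_zpow_neg_mul {q : ℂ} (hq0 : q ≠ 0) (m k : ℕ) :
    qFac q (q ^ (-((m + k : ℕ) : ℤ))) k * qFac q q m * q ^ (m * k + k * (k + 1) / 2) =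
      (-1) ^ k * qFac q q (m + k) := by
  induction k with
  | zero => simp
  | succ k ih =>
    have h1 : q ^ (-((m + (k + 1) : ℕ) : ℤ)) * q = q ^ (-((m + k : ℕ) : ℤ)) := by
      rw [← zpow_add_one₀ hq0]
      congr 1
      push_cast
      ring
    have h2 : (k + 1) * (k + 1 + 1) / 2 = k * (k + 1) / 2 + (k + 1) := by
      have := Nat.triangle_succ (k + 1)
      rw [Nat.add_sub_cancel, Nat.add_sub_cancel] at this
      rw [mul_comm, this, mul_comm (k + 1) k]
    have h3 : q ^ (-((m + (k + 1) : ℕ) : ℤ)) * q ^ (m + k + 1) = 1 := by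
      rw [← zpow_natCast, ← zpow_add₀ hq0]
      simp [add_assoc]
    rw [qFac_succ', h1, h2, ← add_assoc, qFac_succ,
      show m * (k + 1) + (k * (k + 1) / 2 + (k + 1)) = (m * k + k * (k + 1) / 2) + (m + k + 1) by
        rw [Nat.mul_succ]; omega, pow_add _ (_ + _), show q * q ^ (m + k) = q ^ (m + k + 1) by ring,
      pow_succ (-1 : ℂ)]
    rw [← add_assoc] at h3
    linear_combination (q ^ (m + k + 1) - 1) * ih - qFac q (q ^ (-((m + k : ℕ) : ℤ))) k *
      qFac q q m * q ^ (m * k + k * (k + 1) / 2) * h3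

theorem qFac_zpow_neg_eq_zero {q : ℂ} (hq0 : q ≠ 0) {n k : ℕ} (h : n < k) :
    qFac q (q ^ (-(n : ℤ))) k = 0 := by
  refine Finset.prod_eq_zero (Finset.mem_range.mpr h) ?_
  rw [← zpow_natCast q n, ← zpow_add₀ hq0]
  simp

theorem vwpFactor_add_mul {q : ℂ} (hq0 : q ≠ 0) (e : ℂ) (m k : ℕ) :
    vwpFactor q (e / q) (m + k) * qFac q (e / q * q ^ (m + k)) k =
      qFac q e (2 * k) * vwpFactor q (e * q ^ (2 * k) / q) m := by
  have hs : ∀ N : ℕ, vwpFactor q (e / q) (N + 1) * qFac q (e / q * q ^ (N + 1)) k =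
      (1 - e * q ^ (2 * N + 1)) * qFac q e (N + k) := by
    intro N
    rw [vwpFactor_div_succ hq0, qFac_add, mul_assoc]
    congr 3
    field_simp
    ring
  cases m with
  | zero =>
    cases k with
    | zero => simp [vwpFactor_eq]
    | succ k =>
      rw [zero_add, hs, vwpFactor_eq, if_pos rfl, mul_one,
        show 2 * (k + 1) = k + (k + 1) + 1 by ring, qFac_succ _ _ (k + (k + 1)),
        show 2 * k + 1 = k + (k + 1) by ring, mul_comm]
  | succ m =>
    rw [show m + 1 + k = m + k + 1 by ring, hs, vwpFactor_div_succ hq0,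
      show m + k + k = 2 * k + m by ring, qFac_add,
      show 2 * (m + k) + 1 = 2 * k + (2 * m + 1) by ring, pow_add]
    ring

/-- The factor acquired by the product `wpProd` when `a` is replaced by `a q^k`. -/
noncomputable def shiftFactor (q a b c d r : ℂ) (k : ℕ) : ℂ :=
  qFac q (a ^ 2 * b * c * d * r) (2 * k) *
      (qFac q (a * b) k * qFac q (a * c) k * qFac q (a * d) k * qFac q (a * r) k) /
    (qFac q (a * b * c * d) k * qFac q (a * b * c * r) k * qFac q (a * b * d * r) k *
      qFac q (a * c * d * r) k)

theorem wpProd_mul_pow {q a b c d r : ℂ} (hq : ‖q‖ < 1) (ha : ‖a‖ < 1)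
    (hb : ‖b‖ < 1) (hc : ‖c‖ < 1) (hd : ‖d‖ < 1) (hr : ‖r‖ < 1) (k : ℕ) :
    wpProd q (a * q ^ k) b c d r = wpProd q a b c d r * shiftFactor q a b c d r k := by
  have hab := norm_mul_lt_one ha hb
  rw [wpProd, wpProd, shiftFactor, show ∀ x, a * q ^ k * x = a * x * q ^ k by intro x; ring,
    show ∀ x, a * q ^ k * x = a * x * q ^ k by intro x; ring,
    show ∀ x, a * q ^ k * x = a * x * q ^ k by intro x; ring,
    show ∀ x, a * q ^ k * x = a * x * q ^ k by intro x; ring,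
    show a * b * q ^ k * c * d = a * b * c * d * q ^ k by ring,
    show a * b * q ^ k * c * r = a * b * c * r * q ^ k by ring,
    show a * b * q ^ k * d * r = a * b * d * r * q ^ k by ring,
    show a * c * q ^ k * d * r = a * c * d * r * q ^ k by ring,
    show (a * q ^ k) ^ 2 * b * c * d * r = a ^ 2 * b * c * d * r * q ^ (2 * k) by ring,
    qFacInf_mul_pow hq (norm_mul_lt_one (norm_mul_lt_one hab hc) hd),
    qFacInf_mul_pow hq (norm_mul_lt_one (norm_mul_lt_one hab hc) hr),
    qFacInf_mul_pow hq (norm_mul_lt_one (norm_mul_lt_one hab hd) hr),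
    qFacInf_mul_pow hq (norm_mul_lt_one (norm_mul_lt_one (norm_mul_lt_one ha hc) hd) hr),
    qFacInf_mul_pow hq hab, qFacInf_mul_pow hq (norm_mul_lt_one ha hc),
    qFacInf_mul_pow hq (norm_mul_lt_one ha hd), qFacInf_mul_pow hq (norm_mul_lt_one ha hr),
    qFacInf_mul_pow hq (norm_sq_mul_lt_one ha hb hc hd hr)]
  simp only [div_eq_mul_inv, mul_inv, inv_inv]
  ring

theorem wpCore_add_mul {q a b c d r : ℂ} (hq0 : q ≠ 0) (hq : ‖q‖ < 1) (m k : ℕ) :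
    wpCore q a b c d r (m + k) * qFac q (q ^ (-((m + k : ℕ) : ℤ))) k * q ^ k =
      (b * c * d * r) ^ k *
        ((qFac q (a * b) k * qFac q (a * c) k * qFac q (a * d) k * qFac q (a * r) k) /
        (qFac q (a * b * c * d) k * qFac q (a * b * c * r) k * qFac q (a * b * d * r) k *
          qFac q (a * c * d * r) k)) * wpCore q (a * q ^ k) b c d r m := by
  have hm := qFac_ne_zero hq hq m
  have hmk := qFac_ne_zero hq hq (m + k)
  have h := qFac_zpow_neg_mul hq0 m k
  have hexp : q ^ ((m + k) * (m + k - 1) / 2) * q ^ k =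
      q ^ (m * (m - 1) / 2) * q ^ (m * k + k * (k + 1) / 2) := by
    rw [← pow_add, ← pow_add]
    congr 1
    have t : ∀ n : ℕ, n * (n - 1) / 2 + n = n * (n + 1) / 2 := fun n => by
      have := Nat.triangle_succ n
      rw [Nat.add_sub_cancel, mul_comm] at this
      rw [this]
    have e : ∀ n : ℕ, 2 * (n * (n + 1) / 2) = n * (n + 1) := fun n =>
      Nat.two_mul_div_two_of_even (Nat.even_mul_succ_self n)
    have t1 := t (m + k)
    have t2 := t m
    have e1 := e (m + k)
    have e2 := e m
    have e3 := e k
    nlinarith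
  have hinv : qFac q (q ^ (-((m + k : ℕ) : ℤ))) k * q ^ (m * k + k * (k + 1) / 2) *
      (qFac q q (m + k))⁻¹ = (-1) ^ k * (qFac q q m)⁻¹ := by
    field_simp
    linear_combination h
  have hneg : (-(b * c * d * r)) ^ (m + k) =
      (-(b * c * d * r)) ^ m * (-1) ^ k * (b * c * d * r) ^ k := by
    rw [pow_add, neg_pow (b * c * d * r) k]
    ring
  have hone : ((-1 : ℂ) ^ k) * (-1) ^ k = 1 := by rw [← mul_pow]; simp
  have hsplit : ∀ x, qFac q x (m + k) = qFac q x k * qFac q (x * q ^ k) m := fun x => by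
    rw [add_comm, qFac_add]
  have hx : ∀ x, a * q ^ k * x = a * x * q ^ k := fun x => by ring
  rw [wpCore_eq, wpCore_eq, hneg, hsplit (a * b), hsplit (a * c), hsplit (a * d), hsplit (a * r),
    hsplit (a * b * c * d), hsplit (a * b * c * r), hsplit (a * b * d * r), hsplit (a * c * d * r),
    hx b, hx c, hx d, hx r,
    show a * b * q ^ k * c * d = a * b * c * d * q ^ k by ring,
    show a * b * q ^ k * c * r = a * b * c * r * q ^ k by ring,
    show a * b * q ^ k * d * r = a * b * d * r * q ^ k by ring,
    show a * c * q ^ k * d * r = a * c * d * r * q ^ k by ring]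
  simp only [div_eq_mul_inv, mul_inv]
  generalize (qFac q q (m + k))⁻¹ = i1 at *
  generalize (qFac q q m)⁻¹ = i2 at *
  generalize q ^ ((m + k) * (m + k - 1) / 2) = w1 at *
  generalize q ^ (m * k + k * (k + 1) / 2) = w2 at *
  generalize qFac q (q ^ (-((m + k : ℕ) : ℤ))) k = f at *
  -- only the powers of `q`, the signs and the factors `(q; q)` are not matched literally
  have hcomb : f * i1 * (-1) ^ k * (w1 * q ^ k) = i2 * q ^ (m * (m - 1) / 2) := by
    rw [hexp]
    linear_combination (-1) ^ k * q ^ (m * (m - 1) / 2) * hinv +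
      i2 * q ^ (m * (m - 1) / 2) * hone
  generalize qFac q (a * b) k = x1
  generalize qFac q (a * c) k = x2
  generalize qFac q (a * d) k = x3
  generalize qFac q (a * r) k = x4
  generalize (qFac q (a * b * c * d) k)⁻¹ = x5
  generalize (qFac q (a * b * c * r) k)⁻¹ = x6
  generalize (qFac q (a * b * d * r) k)⁻¹ = x7
  generalize (qFac q (a * c * d * r) k)⁻¹ = x8
  generalize qFac q (a * b * q ^ k) m = y1
  generalize qFac q (a * c * q ^ k) m = y2
  generalize qFac q (a * d * q ^ k) m = y3
  generalize qFac q (a * r * q ^ k) m = y4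
  generalize (qFac q (a * b * c * d * q ^ k) m)⁻¹ = y5
  generalize (qFac q (a * b * c * r * q ^ k) m)⁻¹ = y6
  generalize (qFac q (a * b * d * r * q ^ k) m)⁻¹ = y7
  generalize (qFac q (a * c * d * r * q ^ k) m)⁻¹ = y8
  generalize (-(b * c * d * r)) ^ m = p1
  generalize (b * c * d * r) ^ k = p2
  linear_combination p1 * p2 * (x1 * x2 * x3 * x4 * x5 * x6 * x7 * x8) *
    (y1 * y2 * y3 * y4 * y5 * y6 * y7 * y8) * hcomb

/-- The terms of the very-well-poised series, multiplied by the first two shifted factorials of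
the inner `₄φ₃`, are the terms of the series with `a` replaced by `a q^k`. -/
theorem wpTerm_add_mul {q a b c d r : ℂ} (hq0 : q ≠ 0) (hq : ‖q‖ < 1) (m k : ℕ) :
    wpTerm q a b c d r (m + k) * (qFac q (q ^ (-((m + k : ℕ) : ℤ))) k *
        qFac q (a ^ 2 * b * c * d * r / q * q ^ (m + k)) k * q ^ k) =
      (b * c * d * r) ^ k * shiftFactor q a b c d r k * wpTerm q (a * q ^ k) b c d r m := by
  have h1 := vwpFactor_add_mul hq0 (a ^ 2 * b * c * d * r) m k
  have h2 := wpCore_add_mul (a := a) (b := b) (c := c) (d := d) (r := r) hq0 hq m k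
  rw [wpTerm, wpTerm, shiftFactor,
    show (a * q ^ k) ^ 2 * b * c * d * r = a ^ 2 * b * c * d * r * q ^ (2 * k) by ring]
  generalize qFac q (q ^ (-((m + k : ℕ) : ℤ))) k = f at *
  generalize qFac q (a ^ 2 * b * c * d * r / q * q ^ (m + k)) k = g at *
  calc _ = (vwpFactor q (a ^ 2 * b * c * d * r / q) (m + k) * g) *
        (wpCore q a b c d r (m + k) * f * q ^ k) := by ring
    _ = _ := by rw [h1, h2]; ring

/-! ### Termwise integration and rearrangement -/

/-- The factor `(β, δ; q)_k / (q, s, t, h; q)_k` of the `k`-th term of either `₄φ₃`. -/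
noncomputable def tailCoeff (q β δ s t h : ℂ) (k : ℕ) : ℂ :=
  qFac q β k * qFac q δ k / (qFac q q k * qFac q s k * qFac q t k * qFac q h k)

theorem phiTerm_four_three (q x y β δ s t h w : ℂ) (k : ℕ) :
    phiTerm q [x, y, β, δ] [s, t, h] w k =
      tailCoeff q β δ s t h k * w ^ k * (qFac q x k * qFac q y k) := by
  simp only [phiTerm, qFacs, tailCoeff, List.map_cons, List.map_nil, List.prod_cons,
    List.prod_nil, mul_one, div_eq_mul_inv, mul_inv]
  ring

theorem exists_norm_tailCoeff_le {q s t h : ℂ} (hq : ‖q‖ < 1) (β δ : ℂ) (hs : ‖s‖ < 1)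
    (ht : ‖t‖ < 1) (hh : ‖h‖ < 1) :
    ∃ M : ℝ, 0 < M ∧ ∀ k, ‖tailCoeff q β δ s t h k‖ ≤ M := by
  obtain ⟨M1, hM1, h1⟩ := exists_norm_qFac_le hq ‖β‖
  obtain ⟨M2, hM2, h2⟩ := exists_norm_qFac_le hq ‖δ‖
  obtain ⟨N1, hN1, h3⟩ := exists_norm_inv_qFac_le hq hq
  obtain ⟨N2, hN2, h4⟩ := exists_norm_inv_qFac_le hq hs
  obtain ⟨N3, hN3, h5⟩ := exists_norm_inv_qFac_le hq ht
  obtain ⟨N4, hN4, h6⟩ := exists_norm_inv_qFac_le hq hh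
  refine ⟨M1 * M2 * (N1 * N2 * N3 * N4), by positivity, fun k => ?_⟩
  rw [tailCoeff, div_eq_mul_inv, mul_inv, mul_inv, mul_inv]
  simp only [norm_mul]
  have i1 := h1 β le_rfl k
  have i2 := h2 δ le_rfl k
  have i3 := h3 q le_rfl k
  have i4 := h4 s le_rfl k
  have i5 := h5 t le_rfl k
  have i6 := h6 h le_rfl k
  gcongr

theorem exists_norm_shiftFactor_le {q a b c d r : ℂ} (hq : ‖q‖ < 1) (ha : ‖a‖ < 1)
    (hb : ‖b‖ < 1) (hc : ‖c‖ < 1) (hd : ‖d‖ < 1) (hr : ‖r‖ < 1) :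
    ∃ M : ℝ, 0 < M ∧ ∀ k, ‖shiftFactor q a b c d r k‖ ≤ M := by
  obtain ⟨M, hM, h1⟩ := exists_norm_qFac_le hq 1
  have hab := norm_mul_lt_one ha hb
  obtain ⟨N1, hN1, h3⟩ := exists_norm_inv_qFac_le hq (norm_mul_lt_one (norm_mul_lt_one hab hc) hd)
  obtain ⟨N2, hN2, h4⟩ := exists_norm_inv_qFac_le hq (norm_mul_lt_one (norm_mul_lt_one hab hc) hr)
  obtain ⟨N3, hN3, h5⟩ := exists_norm_inv_qFac_le hq (norm_mul_lt_one (norm_mul_lt_one hab hd) hr)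
  obtain ⟨N4, hN4, h6⟩ := exists_norm_inv_qFac_le hq
    (norm_mul_lt_one (norm_mul_lt_one (norm_mul_lt_one ha hc) hd) hr)
  refine ⟨M * (M * M * M * M) * (N1 * N2 * N3 * N4), by positivity, fun k => ?_⟩
  have i1 := h1 _ (norm_sq_mul_lt_one ha hb hc hd hr).le (2 * k)
  have i2 := h1 _ hab.le k
  have i3 := h1 _ (norm_mul_lt_one ha hc).le k
  have i4 := h1 _ (norm_mul_lt_one ha hd).le k
  have i5 := h1 _ (norm_mul_lt_one ha hr).le k
  have j1 := h3 _ le_rfl k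
  have j2 := h4 _ le_rfl k
  have j3 := h5 _ le_rfl k
  have j4 := h6 _ le_rfl k
  rw [shiftFactor, div_eq_mul_inv, mul_inv, mul_inv, mul_inv]
  simp only [norm_mul (_ * _), norm_mul (qFac _ _ _), norm_mul (_⁻¹)]
  gcongr

/-- The term of the double series behind both sides: its sum over `m` is, up to a constant, the
integral of the `k`-th term of the integrand, and its sum over `k + m = n` is the `n`-th term of the
right-hand side. -/
noncomputable def doubleTerm (q a b c d r s t h z β δ : ℂ) (p : ℕ × ℕ) : ℂ :=
  tailCoeff q β δ s t h p.1 * (b * c * d * r * z) ^ p.1 * shiftFactor q a b c d r p.1 *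
    wpTerm q (a * q ^ p.1) b c d r p.2

theorem summable_norm_doubleTerm {q a b c d r s t h z : ℂ} (β δ : ℂ) (hq0 : q ≠ 0) (hq : ‖q‖ < 1)
    (ha : ‖a‖ < 1) (hb : ‖b‖ < 1) (hc : ‖c‖ < 1) (hd : ‖d‖ < 1) (hr : ‖r‖ < 1) (hs : ‖s‖ < 1)
    (ht : ‖t‖ < 1) (hh : ‖h‖ < 1) (hz : ‖z‖ ≤ 1) :
    Summable fun p => ‖doubleTerm q a b c d r s t h z β δ p‖ := by
  obtain ⟨M1, hM1, h1⟩ := exists_norm_tailCoeff_le hq β δ hs ht hh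
  obtain ⟨M2, hM2, h2⟩ := exists_norm_shiftFactor_le hq ha hb hc hd hr
  obtain ⟨M3, hM3, h3⟩ := exists_norm_wp_le hq0 hq ha
  have hw := norm_mul_lt_one (norm_mul_lt_one (norm_mul_lt_one hb hc) hd) hr
  have hwz : ‖b * c * d * r * z‖ < 1 := by
    rw [norm_mul]
    exact mul_lt_one_of_nonneg_of_lt_one_left (norm_nonneg _) hw hz
  have hg := (summable_geometric_of_lt_one (norm_nonneg _) hwz).mul_of_nonneg
    (summable_geometric_of_lt_one (norm_nonneg _) hw) (fun _ => by positivity)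
    (fun _ => by positivity)
  refine .of_nonneg_of_le (fun _ => norm_nonneg _) (fun p => ?_) (hg.mul_left (M1 * M2 * M3))
  have hk : ‖a * q ^ p.1‖ ≤ ‖a‖ := by
    rw [norm_mul, norm_pow]
    exact mul_le_of_le_one_right (norm_nonneg _) (pow_le_one₀ (norm_nonneg _) hq.le)
  have i3 := (h3 (a * q ^ p.1) b c d r hk hb hc hd hr p.2).1
  rw [doubleTerm, norm_mul, norm_mul, norm_mul, norm_pow]
  calc _ ≤ M1 * ‖b * c * d * r * z‖ ^ p.1 * M2 * (M3 * ‖b * c * d * r‖ ^ p.2) := by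
        gcongr
        · exact h1 _
        · exact h2 _
    _ = _ := by ring

theorem rhsTerm_eq_sum_antidiagonal {q a b c d r s t h z β δ : ℂ} (hq0 : q ≠ 0) (hq : ‖q‖ < 1)
    (n : ℕ) :
    rhsTerm q a b c d r s t h z β δ (a ^ 2 * b * c * d * r / q) n =
      ∑ p ∈ Finset.HasAntidiagonal.antidiagonal n, doubleTerm q a b c d r s t h z β δ p := by
  have hphi : phi q [q ^ (-(n : ℤ)), a ^ 2 * b * c * d * r / q * q ^ n, β, δ] [s, t, h] (q * z) =
      ∑ k ∈ Finset.range n.succ,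
        phiTerm q [q ^ (-(n : ℤ)), a ^ 2 * b * c * d * r / q * q ^ n, β, δ] [s, t, h] (q * z) k :=
    tsum_eq_sum fun k hk => by
      rw [phiTerm_four_three, qFac_zpow_neg_eq_zero hq0 (by simpa using hk)]
      ring
  have hw : rhsTerm q a b c d r s t h z β δ (a ^ 2 * b * c * d * r / q) n =
      wpTerm q a b c d r n * phi q [q ^ (-(n : ℤ)), a ^ 2 * b * c * d * r / q * q ^ n, β, δ]
        [s, t, h] (q * z) := by
    simp only [rhsTerm, wpTerm, wpCore, mul_div_assoc, mul_assoc]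
  rw [hw, hphi, Finset.mul_sum, Finset.Nat.sum_antidiagonal_eq_sum_range_succ_mk]
  refine Finset.sum_congr rfl fun k hk => ?_
  obtain ⟨m, rfl⟩ : ∃ m, n = m + k :=
    ⟨n - k, (Nat.sub_add_cancel (Nat.lt_succ_iff.mp (Finset.mem_range.mp hk))).symm⟩
  have h1 := wpTerm_add_mul (a := a) (b := b) (c := c) (d := d) (r := r) hq0 hq m k
  rw [phiTerm_four_three, doubleTerm, Nat.add_sub_cancel, mul_pow, mul_pow _ z]
  linear_combination tailCoeff q β δ s t h k * z ^ k * h1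

theorem summable_norm_sum_antidiagonal {f : ℕ × ℕ → ℂ} (hf : Summable fun p => ‖f p‖) :
    Summable fun n => ‖∑ p ∈ Finset.HasAntidiagonal.antidiagonal n, f p‖ := by
  have h := (Finset.HasAntidiagonal.sigmaAntidiagonalEquivProd (A := ℕ)).summable_iff.mpr hf
  refine .of_nonneg_of_le (fun _ => norm_nonneg _) (fun n => ?_) h.sigma
  rw [tsum_fintype]
  refine (norm_sum_le _ _).trans (le_of_eq ?_)
  rw [← Finset.sum_coe_sort]
  rfl

/-- Summation of an absolutely convergent double series along antidiagonals. -/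
theorem tsum_sum_antidiagonal {f : ℕ × ℕ → ℂ} (hf : Summable f) :
    ∑' n, ∑ p ∈ Finset.HasAntidiagonal.antidiagonal n, f p = ∑' k, ∑' m, f (k, m) := by
  have h := (Finset.HasAntidiagonal.sigmaAntidiagonalEquivProd (A := ℕ)).summable_iff.mpr hf
  rw [← hf.tsum_prod, ← (Finset.HasAntidiagonal.sigmaAntidiagonalEquivProd (A := ℕ)).tsum_eq f]
  refine Eq.trans ?_ h.tsum_sigma.symm
  refine tsum_congr fun n => ?_
  rw [tsum_fintype, ← Finset.sum_coe_sort]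
  rfl

theorem betaIntegrand_mul_pow_cons {q a : ℂ} (hq : ‖q‖ < 1) (ha : ‖a‖ < 1) (L : List ℂ) (k : ℕ)
    (θ : ℝ) :
    betaIntegrand q (a * q ^ k :: L) θ =
      betaIntegrand q (a :: L) θ * (qFac q (a * Complex.exp (θ * Complex.I)) k *
        qFac q (a * Complex.exp (-(θ * Complex.I))) k) := by
  have n1 : ‖a * Complex.exp (θ * Complex.I)‖ < 1 := by
    rwa [norm_mul, Complex.norm_exp_ofReal_mul_I, mul_one]
  have n2 : ‖a * Complex.exp (-(θ * Complex.I))‖ < 1 := by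
    rwa [norm_mul, norm_exp_neg_ofReal_mul_I, mul_one]
  have e : ∀ x, a * q ^ k * x = a * x * q ^ k := fun x => by ring
  simp only [betaIntegrand, hFuns_cons q _ a, hFuns_cons q _ (a * q ^ k), hFun_cos_eq_mul hq, e,
    qFacInf_mul_pow hq n1, qFacInf_mul_pow hq n2, div_eq_mul_inv, mul_inv, inv_inv]
  ring

end QBeta

theorem theorem1p6 (q : ℝ) (hq0 : 0 < q) (hq1 : q < 1)
    (a b c d r s t h z β δ α : ℂ)
    (hα : α = a ^ 2 * b * c * d * r / q)
    (ha : ‖a‖ < 1) (hb : ‖b‖ < 1) (hc : ‖c‖ < 1) (hd : ‖d‖ < 1) (hr : ‖r‖ < 1)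
    (hs : ‖s‖ < 1) (ht : ‖t‖ < 1) (hh : ‖h‖ < 1)
    (hz : ‖z‖ < 1 ∨
      (‖z‖ = 1 ∧ Summable fun n : ℕ => ‖QBeta.rhsTerm q a b c d r s t h z β δ α n‖)) :
    (∀ θ : ℝ, Summable fun n : ℕ =>
      ‖QBeta.phiTerm q
        [a * Complex.exp (θ * Complex.I), a * Complex.exp (-(θ * Complex.I)), β, δ] [s, t, h]
        (b * c * d * r * z) n‖) ∧
    IntervalIntegrable (QBeta.lhsIntegrand q a b c d r s t h z β δ) volume 0 Real.pi ∧
    (Summable fun n : ℕ => ‖QBeta.rhsTerm q a b c d r s t h z β δ α n‖) ∧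
    ∫ θ in (0 : ℝ)..Real.pi, QBeta.lhsIntegrand q a b c d r s t h z β δ θ =
      2 * Real.pi *
          QBeta.qFacsInf q [a * b * c * d, a * b * c * r, a * b * d * r, a * c * d * r] /
          QBeta.qFacsInf q [q, a * b, a * c, a * d, a * r, b * c, b * d, b * r, c * d, c * r,
            d * r, q * α] *
        ∑' n : ℕ, QBeta.rhsTerm q a b c d r s t h z β δ α n := by
  open QBeta in
  have hq : ‖(q : ℂ)‖ < 1 := by simpa [abs_of_pos hq0] using hq1
  have hqc : (q : ℂ) ≠ 0 := by exact_mod_cast hq0.ne'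
  have hz1 : ‖z‖ ≤ 1 := hz.elim le_of_lt fun h => h.1.le
  set w := b * c * d * r * z with hw
  have hwn : ‖w‖ < 1 := by
    rw [hw, norm_mul]
    exact mul_lt_one_of_nonneg_of_lt_one_left (norm_nonneg _)
      (norm_mul_lt_one (norm_mul_lt_one (norm_mul_lt_one hb hc) hd) hr) hz1
  obtain ⟨M, hM0, hM⟩ := exists_norm_qFac_le hq 1
  obtain ⟨N, hN0, hN⟩ := exists_norm_tailCoeff_le hq β δ hs ht hh
  have hgeo : Summable fun k : ℕ => N * ‖w‖ ^ k * (M * M) :=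
    ((summable_geometric_of_lt_one (norm_nonneg _) hwn).mul_left N).mul_right _
  have hphi : ∀ (k : ℕ) (θ : ℝ), ‖phiTerm q
      [a * Complex.exp (θ * Complex.I), a * Complex.exp (-(θ * Complex.I)), β, δ] [s, t, h] w k‖ ≤
      N * ‖w‖ ^ k * (M * M) := by
    intro k θ
    rw [phiTerm_four_three, norm_mul, norm_mul, norm_mul, norm_pow]
    gcongr
    · exact hN k
    · exact hM _ (by rw [norm_mul, Complex.norm_exp_ofReal_mul_I, mul_one]; exact ha.le) k
    · exact hM _ (by rw [norm_mul, norm_exp_neg_ofReal_mul_I, mul_one]; exact ha.le) k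
  have hphis : ∀ θ : ℝ, Summable fun k : ℕ => ‖phiTerm q
      [a * Complex.exp (θ * Complex.I), a * Complex.exp (-(θ * Complex.I)), β, δ] [s, t, h] w k‖ :=
    fun θ => .of_nonneg_of_le (fun _ => norm_nonneg _) (fun k => hphi k θ) hgeo
  have hphic : ∀ k : ℕ, Continuous fun θ : ℝ => phiTerm q
      [a * Complex.exp (θ * Complex.I), a * Complex.exp (-(θ * Complex.I)), β, δ] [s, t, h] w
        k := by
    intro k
    simp only [phiTerm_four_three]
    have := (differentiable_qFac q k).continuous
    fun_prop
  have hL : ∀ x ∈ [a, b, c, d, r], ‖x‖ < 1 := by simp [ha, hb, hc, hd, hr]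
  have hbc := continuous_betaIntegrand hq hL
  have hlc : Continuous (lhsIntegrand q a b c d r s t h z β δ) :=
    hbc.mul (continuous_tsum hphic hgeo hphi)
  have hdouble := summable_norm_doubleTerm β δ hqc hq ha hb hc hd hr hs ht hh hz1
  have hrhs : ∀ n, rhsTerm q a b c d r s t h z β δ α n =
      ∑ p ∈ Finset.HasAntidiagonal.antidiagonal n, doubleTerm q a b c d r s t h z β δ p := by
    intro n
    rw [hα, rhsTerm_eq_sum_antidiagonal hqc hq]
  refine ⟨hphis, hlc.intervalIntegrable _ _, ?_, ?_⟩
  · simp only [hrhs]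
    exact summable_norm_sum_antidiagonal hdouble
  -- The `k`-th term of the integrand is again a `q`-beta integrand, with `a q^k` in place of `a`.
  have hterm : ∀ k : ℕ, (∫ θ in (0 : ℝ)..Real.pi, betaIntegrand q [a, b, c, d, r] θ * phiTerm q
      [a * Complex.exp (θ * Complex.I), a * Complex.exp (-(θ * Complex.I)), β, δ] [s, t, h] w k) =
      2 * Real.pi / qFacInf q q * wpProd q a b c d r *
        ∑' m, doubleTerm q a b c d r s t h z β δ (k, m) := by
    intro k
    have e : ∀ θ : ℝ, betaIntegrand q [a, b, c, d, r] θ * phiTerm q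
        [a * Complex.exp (θ * Complex.I), a * Complex.exp (-(θ * Complex.I)), β, δ] [s, t, h] w k =
        tailCoeff q β δ s t h k * w ^ k * betaIntegrand q [a * q ^ k, b, c, d, r] θ := fun θ => by
      rw [phiTerm_four_three, betaIntegrand_mul_pow_cons hq ha]
      ring
    have h5 := betaIntegral_five hq0 hq1 (norm_mul_pow_lt_one hq ha k) hb hc hd hr
    rw [betaIntegral] at h5
    simp only [e, doubleTerm]
    rw [intervalIntegral.integral_const_mul, h5, wpProd_mul_pow hq ha hb hc hd hr, tsum_mul_left]
    ring
  have hsum : HasSum (fun k : ℕ => ∫ θ in (0 : ℝ)..Real.pi,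
      betaIntegrand q [a, b, c, d, r] θ * phiTerm q
        [a * Complex.exp (θ * Complex.I), a * Complex.exp (-(θ * Complex.I)), β, δ] [s, t, h] w k)
      (∫ θ in (0 : ℝ)..Real.pi, lhsIntegrand q a b c d r s t h z β δ θ) := by
    refine intervalIntegral.hasSum_integral_of_dominated_convergence
      (fun k θ => ‖betaIntegrand q [a, b, c, d, r] θ‖ * (N * ‖w‖ ^ k * (M * M)))
      (fun k => (hbc.mul (hphic k)).aestronglyMeasurable) (fun k => .of_forall fun θ _ => ?_)
      (.of_forall fun θ _ => hgeo.mul_left _) ?_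
      (.of_forall fun θ _ => (hphis θ).of_norm.hasSum.mul_left _)
    · rw [norm_mul]
      gcongr
      exact hphi k θ
    · simp only [tsum_mul_left]
      exact (hbc.norm.mul continuous_const).intervalIntegrable _ _
  rw [← hsum.tsum_eq]
  simp only [hterm, hrhs]
  rw [tsum_mul_left, tsum_sum_antidiagonal hdouble.of_norm]
  congr 1
  have hqα : q * α = a ^ 2 * b * c * d * r := by
    rw [hα]
    field_simp
  simp only [qFacsInf, wpProd, hqα, List.map_cons, List.map_nil, List.prod_cons, List.prod_nil,
    mul_one, div_eq_mul_inv, mul_inv]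
  ring
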